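/- **Setting.** Fix disjoint supplies of predicates (each with an arity $\ge 1$), variables and constants, all named by finite words. An *atom* is $P(t_1,\dots,t_n)$ with $P$ an $n$-ary predicate other than equality. A *rule* is a first-order sentence without constants and function symbols that is either a TGD $\forall \vec x,\vec y\,.\,(\beta[\vec x,\vec y]\to\exists \vec w\,.\,\eta[\vec x,\vec w])$ or an EGD $\forall \vec x\,.\,(\beta[\vec x]\to x\approx y)$, where $\vec x,\vec y,\vec w$ are pairwise disjoint, $\vec x$ is non-empty, $\beta,\eta$ are non-empty conjunctions of atoms in exactly the indicated variables, and $x,y\in\vec x$. A *rule set* $R$ is a finite set of rules in which no existentially quantified variable of a rule occurs in another rule. An *ontology* is a pair $\langle R,F\rangle$ of a rule set $R$ and a finite set $F$ of facts (atoms all of whose arguments are constants), all of whose predicates occur in $R$. A *Boolean conjunctive query* (BCQ) is $\gamma=\exists\vec x\,.\,\beta[\vec x]$ with $\beta$ a non-empty conjunction of atoms over variables. $\langle R,F\rangle\models\gamma$ denotes first-order entailment, with $\approx$ interpreted as equality and without the unique name assumption. For a TGD as above and a map $\theta$ from variables to ground terms, let $\theta(\mathrm{sk}(\eta))$ be obtained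 from $\eta$ by replacing each $w\in\vec w$ by $f_w(\theta(\vec x))$, with $f_w$ a function symbol unique for $w$, and each $x\in\vec x$ by $\theta(x)$. Constants have depth $1$, and a term $f(t_1,\dots,t_n)$ has depth $1+\max_i\mathrm{depth}(t_i)$. Let $A[t/u]$ be the result of replacing in the atoms of $A$ every predicate argument equal to $t$ by $u$ (without replacing inside terms). Let $\mathrm{EMFA}(R)$ be the least set $A$ of atoms such that 1. $P(\star,\dots,\star)\in A$ for every predicate $P$ occurring in $R$, with $\star$ a special constant; 2. if $\beta\to\exists\vec w\,.\,\eta$ is a TGD in $R$ and $\beta\theta\subseteq A$, then $\theta(\mathrm{sk}(\eta))\subseteq A$; 3. if $\beta\to x\approx y$ is an EGD in $R$ and $\beta\theta\subseteq A$, then $A[\theta(y)/\theta(x)]\subseteq A$ if $\mathrm{depth}(\theta(x))\le\mathrm{depth}(\theta(y))$, and $A[\theta(x)/\theta(y)]\subseteq A$ if $\mathrm{depth}(\theta(y))\le\mathrm{depth}(\theta(x))$. A term $f(\vec u)$ is *cyclic* if $f$ occurs in a term of $\vec u$. The rule set $R$ is *EMFA* (equality model-faithful acyclic) if no cyclic term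 occurs in $\mathrm{EMFA}(R)$. **Theorem.** The following problem is $\textsc{2ExpTime}$-hard under polynomial-time many-one reductions: given an ontology $\langle R,F\rangle$ with $R$ an EMFA rule set and a BCQ $\gamma$, decide whether $\langle R,F\rangle\models\gamma$. That is, for every language $L\subseteq\{0,1\}^*$ that is decided by a deterministic Turing machine within $2^{2^{p(n)}}$ steps on inputs of length $n$, for some polynomial $p$, there is a polynomial-time computable function that maps each word $x$ to (the encoding of) an ontology $\langle R_x,F_x\rangle$ with $R_x$ an EMFA rule set and a BCQ $\gamma_x$ such that $x\in L$ if and only if $\langle R_x,F_x\rangle\models\gamma_x$. -/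

import Mathlib

namespace ExRules

/-! ### Syntax of existential rules with equality -/

/-- Predicate names, variable names and constant names are finite bit strings. -/
abbrev Name : Type := List Bool

/-- An equality-free atom `P(t₁, …, tₙ)` whose arguments are taken from `τ`. -/
structure Atom (τ : Type) where
  pred : Name
  args : List τ

/-- Apply `f` to every argument of an atom. -/
def Atom.map {τ υ : Type} (f : τ → υ) (a : Atom τ) : Atom υ :=
  ⟨a.pred, a.args.map f⟩

/-- All arguments occurring in a list of atoms. -/
def argsOf {τ : Type} (as : List (Atom τ)) : List τ :=
  as.flatMap Atom.args

/-- Existential rules, without function symbols and constants: all arguments are variables.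
* `tgd β η` is `∀ x y, β[x, y] → ∃ w, η[x, w]`, where `w` is the set of the variables of `η` that
  do not occur in `β` and `x` is the set of the variables that occur in both;
* `egd β x y` is `∀ x, β[x] → x ≈ y`. -/
inductive Rule where
  | tgd (body head : List (Atom Name))
  | egd (body : List (Atom Name)) (x y : Name)

/-- The relational atoms of a rule. -/
def Rule.atoms : Rule → List (Atom Name)
  | tgd β η => β ++ η
  | egd β _ _ => β

/-- The existentially quantified variables of a rule (possibly listed with repetitions). -/
def Rule.exVars : Rule → List Name
  | tgd β η => (argsOf η).filter (fun v => v ∉ argsOf β)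
  | egd _ _ _ => []

/-- The variables shared by the body and the head of a TGD, listed without repetitions. -/
def sharedVars (β η : List (Atom Name)) : List Name :=
  (argsOf β).dedup.filter (fun v => v ∈ argsOf η)

/-- Side conditions on a single rule: body and head are non-empty; a TGD has at least one variable
shared by body and head; the variables equated by an EGD occur in its body. -/
def Rule.WellFormed : Rule → Prop
  | tgd β η => β ≠ [] ∧ η ≠ [] ∧ sharedVars β η ≠ []
  | egd β x y => β ≠ [] ∧ x ∈ argsOf β ∧ y ∈ argsOf β

/-- An input of the BCQ entailment problem: a finite rule set, a finite set of facts over constants,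
and the body of a Boolean conjunctive query, all of whose variables are existentially quantified. -/
structure Instance where
  rules : List Rule
  facts : List (Atom Name)
  query : List (Atom Name)

/-- All atoms occurring in a rule set. -/
def ruleAtoms (R : List Rule) : List (Atom Name) :=
  R.flatMap Rule.atoms

/-- `⟨R, F⟩` is an ontology and `γ` a BCQ over a common signature. -/
structure Instance.WellFormed (i : Instance) : Prop where
  /-- every predicate has one arity, which is at least one -/
  arity : ∃ ar : Name → ℕ, (∀ p, 1 ≤ ar p) ∧
    ∀ a ∈ ruleAtoms i.rules ++ i.facts ++ i.query, a.args.length = ar a.pred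
  rules_wf : ∀ ρ ∈ i.rules, ρ.WellFormed
  /-- existentially quantified variables do not reoccur in other rules -/
  exVars_unique : ∀ ρ ∈ i.rules, ∀ ρ' ∈ i.rules, ∀ w ∈ ρ.exVars, w ∈ argsOf ρ'.atoms → ρ = ρ'
  /-- the predicates of the facts occur in the rules -/
  facts_pred : ∀ a ∈ i.facts, ∃ b ∈ ruleAtoms i.rules, b.pred = a.pred
  query_ne : i.query ≠ []

/-! ### First-order semantics -/

/-- A first-order interpretation of predicates and constants over the domain `D`; the equality
predicate is interpreted as equality on `D`, and different constants may denote the same element. -/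
structure Interp (D : Type) where
  pred : Name → List D → Prop
  const : Name → D

/-- Truth of an atom whose arguments are domain elements. -/
def Interp.Holds {D : Type} (I : Interp D) (a : Atom D) : Prop :=
  I.pred a.pred a.args

/-- Truth of a rule. -/
def Interp.SatRule {D : Type} (I : Interp D) : Rule → Prop
  | .tgd β η => ∀ σ : Name → D, (∀ a ∈ β, I.Holds (a.map σ)) →
      ∃ τ : Name → D, (∀ v ∈ argsOf β, τ v = σ v) ∧ ∀ a ∈ η, I.Holds (a.map τ)
  | .egd β x y => ∀ σ : Name → D, (∀ a ∈ β, I.Holds (a.map σ)) → σ x = σ y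

/-- Truth of a BCQ. -/
def Interp.SatQuery {D : Type} (I : Interp D) (γ : List (Atom Name)) : Prop :=
  ∃ σ : Name → D, ∀ a ∈ γ, I.Holds (a.map σ)

/-- `⟨R, F⟩ ⊨ γ` under first-order semantics (non-empty domains). -/
def Instance.Entails (i : Instance) : Prop :=
  ∀ (D : Type) [Nonempty D] (I : Interp D),
    (∀ ρ ∈ i.rules, I.SatRule ρ) → (∀ a ∈ i.facts, I.Holds (a.map I.const)) → I.SatQuery i.query

/-! ### Equality model-faithful acyclicity -/

/-- Ground terms over the special constant `⋆`, the other constants, and the Skolem function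
symbols `f_w`; the symbol `f_w` is identified with the existentially quantified variable `w`. -/
inductive GTerm where
  | star : GTerm
  | const (c : Name) : GTerm
  | app (w : Name) (ts : List GTerm) : GTerm

mutual
/-- Depth of a term: constants have depth 1. -/
def GTerm.depth : GTerm → ℕ
  | .star => 1
  | .const _ => 1
  | .app _ ts => depthList ts + 1
/-- Maximal depth of the terms in a list. -/
def depthList : List GTerm → ℕ
  | [] => 0
  | t :: ts => max t.depth (depthList ts)
end

mutual
/-- The function symbols occurring in a term. -/
def GTerm.syms : GTerm → List Name
  | .star => []
  | .const _ => []
  | .app w ts => w :: symsList ts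
/-- The function symbols occurring in a list of terms. -/
def symsList : List GTerm → List Name
  | [] => []
  | t :: ts => t.syms ++ symsList ts
end

mutual
/-- The subterms of a term, including the term itself. -/
def GTerm.subterms : GTerm → List GTerm
  | .star => [.star]
  | .const c => [.const c]
  | .app w ts => .app w ts :: subtermsList ts
/-- The subterms of the terms in a list. -/
def subtermsList : List GTerm → List GTerm
  | [] => []
  | t :: ts => t.subterms ++ subtermsList ts
end

/-- A term `f(u)` is cyclic if `f` occurs in some term in `u`. -/
def GTerm.Cyclic : GTerm → Prop
  | .star => False
  | .const _ => False
  | .app w ts => ∃ t ∈ ts, w ∈ t.syms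

/-- The value, under the substitution `σ`, of a variable in the skolemised head of `β → ∃ w, η`:
universally quantified variables go to `σ v`, and an existentially quantified variable `w` to
`f_w(σ x₁, …, σ xₖ)` with `x₁, …, xₖ` the variables shared by `β` and `η`. -/
def skolemSubst (β η : List (Atom Name)) (σ : Name → GTerm) (v : Name) : GTerm :=
  if v ∈ argsOf β then σ v else .app v ((sharedVars β η).map σ)

open Classical in
/-- The function `[t / u]` on terms: it replaces `t` by `u` and fixes every other term. -/
noncomputable def replace (t u s : GTerm) : GTerm :=
  if s = t then u else s

/-- The minimal atom set that contains the critical instance of `R` and is closed under the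
skolemised TGDs of `R` and under replacing, as predicate arguments, deeper by shallower terms that
an EGD of `R` equates (in both directions if they have equal depth). -/
inductive EMFASet (R : List Rule) : Atom GTerm → Prop
  | critical (a : Atom Name) (h : a ∈ ruleAtoms R) :
      EMFASet R (a.map fun _ => GTerm.star)
  | tgd (β η : List (Atom Name)) (h : Rule.tgd β η ∈ R) (σ : Name → GTerm)
      (hβ : ∀ b ∈ β, EMFASet R (b.map σ)) (a : Atom Name) (ha : a ∈ η) :
      EMFASet R (a.map (skolemSubst β η σ))
  | egd_left (β : List (Atom Name)) (x y : Name) (h : Rule.egd β x y ∈ R) (σ : Name → GTerm)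
      (hβ : ∀ b ∈ β, EMFASet R (b.map σ)) (hd : (σ x).depth ≤ (σ y).depth)
      (a : Atom GTerm) (ha : EMFASet R a) :
      EMFASet R (a.map (replace (σ y) (σ x)))
  | egd_right (β : List (Atom Name)) (x y : Name) (h : Rule.egd β x y ∈ R) (σ : Name → GTerm)
      (hβ : ∀ b ∈ β, EMFASet R (b.map σ)) (hd : (σ y).depth ≤ (σ x).depth)
      (a : Atom GTerm) (ha : EMFASet R a) :
      EMFASet R (a.map (replace (σ x) (σ y)))

/-- `R` is EMFA: no cyclic term occurs in the atom set `EMFASet R`. -/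
def IsEMFA (R : List Rule) : Prop :=
  ∀ a, EMFASet R a → ∀ t ∈ a.args, ∀ s ∈ t.subterms, ¬ s.Cyclic

/-! ### Encoding of inputs as words over a finite alphabet -/

/-- The alphabet: bits, list delimiters, and tags for the two kinds of rules. -/
inductive Letter where
  | bit (b : Bool)
  | item
  | close
  | tgdTag
  | egdTag
deriving DecidableEq, Fintype

/-- Encoding of a list: each entry is preceded by `item`; the list is closed by `close`. -/
def encList {α : Type} (e : α → List Letter) : List α → List Letter
  | [] => [.close]
  | a :: l => .item :: (e a ++ encList e l)

/-- Encoding of a name: its bits, closed by `close`. -/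
def encName (n : Name) : List Letter :=
  n.map Letter.bit ++ [.close]

/-- Encoding of an atom. -/
def encAtom (a : Atom Name) : List Letter :=
  encName a.pred ++ encList encName a.args

/-- Encoding of a rule. -/
def encRule : Rule → List Letter
  | .tgd β η => .tgdTag :: (encList encAtom β ++ encList encAtom η)
  | .egd β x y => .egdTag :: (encList encAtom β ++ (encName x ++ encName y))

/-- Encoding of an input of the BCQ entailment problem. -/
def Instance.encode (i : Instance) : List Letter :=
  encList encRule i.rules ++ (encList encAtom i.facts ++ encList encAtom i.query)

/-- `e` can be decoded from a prefix of a longer word. -/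
def PrefixInj {α : Type} (e : α → List Letter) : Prop :=
  ∀ a b s t, e a ++ s = e b ++ t → a = b ∧ s = t

theorem prefixInj_encName : PrefixInj encName := by
  intro a
  induction a with
  | nil =>
    intro b s t h
    cases b <;> simp_all [encName]
  | cons x a ih =>
    intro b s t h
    cases b with
    | nil => simp [encName] at h
    | cons y b =>
      simp only [encName, List.map_cons, List.cons_append, List.cons.injEq,
        Letter.bit.injEq] at h
      obtain ⟨h1, h2⟩ := ih b s t h.2
      exact ⟨by rw [h.1, h1], h2⟩

theorem prefixInj_encList {α : Type} {e : α → List Letter} (he : PrefixInj e) :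
    PrefixInj (encList e) := by
  intro a
  induction a with
  | nil =>
    intro b s t h
    cases b <;> simp_all [encList]
  | cons x a ih =>
    intro b s t h
    cases b with
    | nil => simp [encList] at h
    | cons y b =>
      simp only [encList, List.cons_append, List.cons.injEq, true_and, List.append_assoc] at h
      obtain ⟨h1, h2⟩ := he _ _ _ _ h
      obtain ⟨h3, h4⟩ := ih _ _ _ h2
      exact ⟨by rw [h1, h3], h4⟩

theorem prefixInj_encAtom : PrefixInj encAtom := by
  rintro ⟨p, l⟩ ⟨q, m⟩ s t h
  simp only [encAtom, List.append_assoc] at h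
  obtain ⟨h1, h2⟩ := prefixInj_encName _ _ _ _ h
  obtain ⟨h3, h4⟩ := prefixInj_encList prefixInj_encName _ _ _ _ h2
  exact ⟨by rw [h1, h3], h4⟩

theorem prefixInj_encRule : PrefixInj encRule := by
  have hl := prefixInj_encList prefixInj_encAtom
  rintro (⟨β, η⟩ | ⟨β, x, y⟩) (⟨β', η'⟩ | ⟨β', x', y'⟩) s t h
  · simp only [encRule, List.cons_append, List.cons.injEq, true_and, List.append_assoc] at h
    obtain ⟨h1, h2⟩ := hl _ _ _ _ h
    obtain ⟨h3, h4⟩ := hl _ _ _ _ h2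
    exact ⟨by rw [h1, h3], h4⟩
  · simp [encRule] at h
  · simp [encRule] at h
  · simp only [encRule, List.cons_append, List.cons.injEq, true_and, List.append_assoc] at h
    obtain ⟨h1, h2⟩ := hl _ _ _ _ h
    obtain ⟨h3, h4⟩ := prefixInj_encName _ _ _ _ h2
    obtain ⟨h5, h6⟩ := prefixInj_encName _ _ _ _ h4
    exact ⟨by rw [h1, h3, h5], h6⟩

/-- Different inputs have different codes. -/
theorem Instance.encode_injective : Function.Injective Instance.encode := by
  rintro ⟨r, f, q⟩ ⟨r', f', q'⟩ h
  simp only [Instance.encode] at h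
  obtain ⟨h1, h2⟩ := prefixInj_encList prefixInj_encRule _ _ _ _ h
  obtain ⟨h3, h4⟩ := prefixInj_encList prefixInj_encAtom _ _ _ _ h2
  obtain ⟨h5, -⟩ := prefixInj_encList prefixInj_encAtom q q' [] [] (by simpa using h4)
  rw [h1, h3, h5]

/-! ### Complexity -/

open Classical in
/-- The class 2ExpTime: languages over `{0, 1}` decided by a deterministic Turing machine that, on
inputs of length `n`, halts within `2 ^ 2 ^ p(n)` steps, for some polynomial `p`. -/
def InTwoExpTime (L : Language Bool) : Prop :=
  ∃ (p : Polynomial ℕ)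
    (M : Turing.TM2ComputableInTime (id : List Bool → List Bool) Computability.encodeBool
      (fun x => decide (x ∈ L))),
    ∀ n, M.time n ≤ 2 ^ 2 ^ p.eval n

/-- The problem "given `i` with `Valid i`, does `Yes i` hold?", with inputs encoded by `enc`, is
2ExpTime-hard under polynomial-time many-one reductions. Reductions produce valid inputs only. -/
def TwoExpTimeHard {α Γ : Type} (enc : α → List Γ) (Valid Yes : α → Prop) : Prop :=
  ∀ L : Language Bool, InTwoExpTime L →
    ∃ f : List Bool → α,
      Nonempty (Turing.TM2ComputableInPolyTime (id : List Bool → List Bool) enc f) ∧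
      ∀ x, Valid (f x) ∧ (x ∈ L ↔ Yes (f x))

end ExRules

-- Hardness already holds for rule sets without EGDs: the reduction produces TGDs only. A machine
-- with running time 2^2^p(n) is simulated along a linear order of 2^2^k time points, where k =
-- b(n+1)^d is polynomial in the input length n. The order arises by repeated squaring. Level 0
-- consists of two constants, `createRule j` provides an element for every pair of elements of level
-- j, and `orderRules j` order these pairs lexicographically, so each level has the square of the
-- previous size (`IsOrder.exists_succ`).
--
-- The Skolem terms created for level j + 1 apply a symbol of their own to terms of level j.
-- Stratifying the predicates by `Sym.level` shows that this persists from the critical instance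
-- through the whole closure, so no symbol is ever nested in itself (`belowLevel_of_emfaSet`).
--
-- Stack contents are linked lists of `node` atoms. A push that leads to time t + 1 takes the time
-- point t + 1 itself as its new cell, so the machine rules need no existential variables. They
-- handle one push or read per time step; `InTwoExpTime.exists_micro` compiles arbitrary stack
-- machines to this form. Only the input alphabet of a given machine is assumed finite, so a pushed
-- symbol is represented by the statement and internal state that pushed it, of which there are
-- finitely many.
--
-- Every model contains the simulated run, hence an accepting computation within the time bound
-- forces the query (`entails_reduction`). Models may identify elements, which does no harm because
-- only positive atoms are derived. Conversely, one model over numbers and words interprets pairing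
-- as positional notation and makes `conf` true only of actual configurations of the run. If the
-- query holds there, the machine accepts (`exists_accepting_of_entails`).
--
-- Indices are written in unary, which is affordable because k is polynomial. The instance is
-- therefore printed by a simple loop program over unary counters, compiled to a stack machine
-- (`reduction_computable`).

namespace ExRules

open Turing

/-! ### A small stack language compiled to stack machines -/

section Cmd

variable {K : Type} {Γ : K → Type}

/-- Programs over finitely many stacks: `each k b` repeatedly pops a symbol `a` from the stack `k`
and runs `b a`, until the stack is empty. -/
inductive Cmd (Γ : K → Type) : Type
  | skip : Cmd Γ
  | push (k : K) (a : Γ k) : Cmd Γ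
  | seq (c d : Cmd Γ) : Cmd Γ
  | each (k : K) (b : Γ k → Cmd Γ) : Cmd Γ

/-- Big-step semantics of programs, counting steps. -/
inductive Cmd.Runs [DecidableEq K] : Cmd Γ → (∀ k, List (Γ k)) → (∀ k, List (Γ k)) → ℕ → Prop
  | skip (S) : Runs .skip S S 1
  | push (k a S) : Runs (.push k a) S (Function.update S k (a :: S k)) 1
  | seq {c d S S' S'' t u} : Runs c S S' t → Runs d S' S'' u → Runs (.seq c d) S S'' (t + u)
  | each_nil {k b S} : S k = [] → Runs (.each k b) S S 1
  | each_cons {k b S a l S' S'' t u} : S k = a :: l → Runs (b a) (Function.update S k l) S' t →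
      Runs (.each k b) S' S'' u → Runs (.each k b) S S'' (t + u + 1)

/-- Labels of the compiled program. -/
def Cmd.Lab : Cmd Γ → Type
  | .skip => Unit
  | .push _ _ => Unit
  | .seq c d => c.Lab ⊕ d.Lab
  | .each k b => Option (Σ a : Γ k, (b a).Lab)

/-- The label at which the compiled program starts. -/
def Cmd.entry : (c : Cmd Γ) → c.Lab
  | .skip => ()
  | .push _ _ => ()
  | .seq c _ => .inl c.entry
  | .each _ _ => none

/-- Programs over finite alphabets have finitely many labels. -/
@[reducible]
noncomputable def Cmd.labFintype [∀ k, Fintype (Γ k)] : (c : Cmd Γ) → Fintype c.Lab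
  | .skip => inferInstanceAs (Fintype Unit)
  | .push _ _ => inferInstanceAs (Fintype Unit)
  | .seq c d =>
    letI := c.labFintype
    letI := d.labFintype
    inferInstanceAs (Fintype (c.Lab ⊕ d.Lab))
  | .each k b =>
    letI := fun a => (b a).labFintype
    inferInstanceAs (Fintype (Option (Σ a : Γ k, (b a).Lab)))

/-- The statement at each label of the compiled program, where labels are embedded by `ι` and the
program is left through the label `exit`. -/
def Cmd.code [DecidableEq K] {Λ : Type} : (c : Cmd Γ) → (c.Lab → Λ) → Λ → c.Lab →
    TM2.Stmt Γ Λ (Option (Σ k, Γ k))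
  | .skip, _, exit, _ => .goto fun _ => exit
  | .push k a, _, exit, _ => .push k (fun _ => a) (.goto fun _ => exit)
  | .seq c d, ι, _, .inl l => c.code (fun l => ι (.inl l)) (ι (.inr d.entry)) l
  | .seq _ d, ι, exit, .inr l => d.code (fun l => ι (.inr l)) exit l
  | .each k b, ι, exit, none =>
      .pop k (fun _ o => o.map (Sigma.mk k)) (.goto fun v =>
        match v with
        | none => exit
        | some ⟨k', a⟩ => if h : k' = k then ι (some ⟨h ▸ a, (b (h ▸ a)).entry⟩) else exit)
  | .each _ b, ι, _, some ⟨a, l⟩ => (b a).code (fun l => ι (some ⟨a, l⟩)) (ι none) l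

/-- The embedding `ι` and the label `exit` are arbitrary so that the induction applies to
subprograms: the body of a loop exits to the head of the loop. The internal state `v` is arbitrary
because a loop head overwrites it by its pop before testing it, and nothing else reads it. -/
theorem Cmd.Runs.iterate [DecidableEq K] {Λ : Type}
    (m : Λ → TM2.Stmt Γ Λ (Option (Σ k, Γ k))) {c : Cmd Γ} {S S' : ∀ k, List (Γ k)} {t : ℕ}
    (h : c.Runs S S' t) : ∀ (ι : c.Lab → Λ) (exit : Λ), (∀ l, m (ι l) = c.code ι exit l) →
      ∀ v, ∃ v', (flip bind (TM2.step m))^[t] (some ⟨some (ι c.entry), v, S⟩) =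
        some ⟨some exit, v', S'⟩ := by
  have one : ∀ (l : Λ) (v) (S : ∀ k, List (Γ k)), flip bind (TM2.step m) (some ⟨some l, v, S⟩) =
      some (TM2.stepAux (m l) v S) := fun _ _ _ => rfl
  induction h with
  | skip S =>
    intro ι exit hm v
    exact ⟨v, (one _ _ _).trans (by rw [hm]; rfl)⟩
  | push k a S =>
    intro ι exit hm v
    exact ⟨v, (one _ _ _).trans (by rw [hm]; rfl)⟩
  | @seq c d S S' S'' t u _ _ ih₁ ih₂ =>
    intro ι exit hm v
    obtain ⟨v₁, h₁⟩ := ih₁ (fun l => ι (.inl l)) (ι (.inr d.entry)) (fun l => hm (.inl l)) v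
    obtain ⟨v₂, h₂⟩ := ih₂ (fun l => ι (.inr l)) exit (fun l => hm (.inr l)) v₁
    refine ⟨v₂, ?_⟩
    rw [add_comm, Function.iterate_add_apply]
    exact (congrArg _ h₁).trans h₂
  | @each_nil k b S hk =>
    intro ι exit hm v
    refine ⟨none, (one _ _ _).trans ?_⟩
    rw [hm]
    simp [entry, code, hk]
  | @each_cons k b S a l S' S'' t u hk _ _ ih₁ ih₂ =>
    intro ι exit hm v
    obtain ⟨v₁, h₁⟩ := ih₁ (fun l => ι (some ⟨a, l⟩)) (ι none) (fun l => hm (some ⟨a, l⟩))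
      (some ⟨k, a⟩)
    obtain ⟨v₂, h₂⟩ := ih₂ ι exit hm v₁
    refine ⟨v₂, ?_⟩
    have h₀ : flip bind (TM2.step m) (some ⟨some (ι (entry (.each k b))), v, S⟩) =
        some ⟨some (ι (some ⟨a, (b a).entry⟩)), some ⟨k, a⟩, Function.update S k l⟩ := by
      rw [one, hm]
      simp [entry, code, hk]
    rw [Function.iterate_succ_apply, h₀, add_comm, Function.iterate_add_apply, h₁]
    exact h₂

/-- The machine that runs a program and halts in its initial state. -/
noncomputable def Cmd.machine [DecidableEq K] [Fintype K] [∀ k, Fintype (Γ k)] (k₀ k₁ : K)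
    (c : Cmd Γ) : FinTM2 :=
  letI := c.labFintype
  { k₀ := k₀
    k₁ := k₁
    Γ := Γ
    Λ := Option c.Lab
    main := some c.entry
    σ := Option (Σ k, Γ k)
    initialState := none
    m := fun
      -- The halting configuration expected of the machine carries the initial internal state, so
      -- the last popped symbol has to be erased.
      | none => .load (fun _ => none) .halt
      | some l => c.code some none l }

/-- A program that transforms the input word into the output word within polynomially many steps
yields a polynomial-time computable function. -/
theorem Cmd.computableInPolyTime [DecidableEq K] [Fintype K] [∀ k, Fintype (Γ k)] {k₀ k₁ : K}
    {α αΓ β βΓ : Type} (ea : α → List αΓ) (eb : β → List βΓ) (f : α → β) (c : Cmd Γ)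
    (e₀ : Γ k₀ ≃ αΓ) (e₁ : Γ k₁ ≃ βΓ) (p : Polynomial ℕ)
    (h : ∀ a, ∃ t ≤ p.eval (ea a).length,
      c.Runs (Function.update (fun _ => []) k₀ ((ea a).map e₀.symm))
        (Function.update (fun _ => []) k₁ ((eb (f a)).map e₁.symm)) t) :
    Nonempty (TM2ComputableInPolyTime ea eb f) := by
  have hi : ∀ (k' : K) (l : List (Γ k')) (k : K), @dite (List (Γ k)) (k = k') (inferInstance)
      (fun h => by rw [h]; exact l) (fun _ => []) = Function.update (fun _ => []) k' l k := by
    intro k' l k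
    by_cases h : k = k'
    · subst h; simp
    · simp [h]
  -- The summand 1 pays for the final step at the exit label.
  refine ⟨{ tm := c.machine k₀ k₁, inputAlphabet := e₀, outputAlphabet := e₁, time := p + 1,
            outputsFun := fun a => ?_ }⟩
  have ht := (h a).choose_spec
  refine ⟨⟨(h a).choose + 1, ?_⟩, ?_⟩
  · obtain ⟨v', hv⟩ := ht.2.iterate (c.machine k₀ k₁).m some none (fun l => rfl) none
    have e1 : initList (c.machine k₀ k₁) ((ea a).map e₀.symm) =
        ⟨some (some c.entry), none, Function.update (fun _ => []) k₀ ((ea a).map e₀.symm)⟩ := by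
      unfold initList
      congr 1
      funext k
      exact hi k₀ _ k
    have e2 : haltList (c.machine k₀ k₁) ((eb (f a)).map e₁.symm) =
        ⟨none, none, Function.update (fun _ => []) k₁ ((eb (f a)).map e₁.symm)⟩ := by
      unfold haltList
      congr 1
      funext k
      exact hi k₁ _ k
    rw [Function.iterate_succ_apply']
    refine (congrArg _ ((congrArg (fun z => (flip bind (c.machine k₀ k₁).step)^[(h a).choose]
      (some z)) e1).trans hv)).trans ?_
    exact (congrArg some e2).symm
  · simpa using ht.1

end Cmd

/-! ### Elementary stack machines -/

/-- Instructions of an elementary stack machine with stacks `K`, alphabet `A`, states `Q`. The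
instruction `read b k f` inspects the top of the stack `k`, and removes it if `b` is true. -/
inductive Instr (K A Q : Type) : Type
  | push (k : K) (a : A) (q : Q)
  | read (remove : Bool) (k : K) (next : Option A → Q)
  | idle

/-- One step of an elementary stack machine. -/
def microStep {K A Q : Type} [DecidableEq K] (δ : Q → Instr K A Q) (c : Q × (K → List A)) :
    Q × (K → List A) :=
  match δ c.1 with
  | .push k a q => (q, Function.update c.2 k (a :: c.2 k))
  | .read b k f => (f (c.2 k).head?, if b then Function.update c.2 k (c.2 k).tail else c.2)
  | .idle => c

/-- The configuration of an elementary stack machine after `t` steps. -/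
def microRun {K A Q : Type} [DecidableEq K] (δ : Q → Instr K A Q) (c : Q × (K → List A)) (t : ℕ) :
    Q × (K → List A) :=
  (microStep δ)^[t] c

theorem microRun_succ {K A Q : Type} [DecidableEq K] (δ : Q → Instr K A Q) (c : Q × (K → List A))
    (t : ℕ) : microRun δ c (t + 1) = microStep δ (microRun δ c t) :=
  Function.iterate_succ_apply' _ _ _

theorem microRun_add {K A Q : Type} [DecidableEq K] (δ : Q → Instr K A Q) (c : Q × (K → List A))
    (s t : ℕ) : microRun δ c (s + t) = microRun δ (microRun δ c s) t := by
  rw [microRun, microRun, microRun, add_comm, Function.iterate_add_apply]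

theorem microRun_of_idle {K A Q : Type} [DecidableEq K] (δ : Q → Instr K A Q)
    (c : Q × (K → List A)) (h : δ c.1 = .idle) (t : ℕ) : microRun δ c t = c := by
  induction t with
  | zero => rfl
  | succ t ih => rw [microRun_succ, ih, microStep, h]

/-! ### Compiling stack machines to elementary stack machines -/

section Micro

variable (M : FinTM2)

/-- The statements that occur in the program, and `none` for the halted machine. -/
abbrev ProgStmt : Type :=
  {s : Option (TM2.Stmt M.Γ M.Λ M.σ) //
    s ∈ TM2.stmts M.m (@Finset.univ M.Λ M.ΛFin)}

/-- States of the elementary machine: a statement to be executed and an internal state, or a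
verdict. -/
abbrev MicroState : Type := (ProgStmt M × M.σ) ⊕ Bool

/-- Stack symbols of the elementary machine: a pushed symbol is represented by the state in which it
was pushed. -/
abbrev MicroSym : Type := (ProgStmt M × M.σ) ⊕ M.Γ M.k₀

variable {M}

theorem mem_stmts_of_label (l : M.Λ) :
    some (M.m l) ∈ TM2.stmts M.m (@Finset.univ M.Λ M.ΛFin) := by
  let _ := M.ΛFin
  simp only [TM2.stmts, Finset.some_mem_insertNone, Finset.mem_biUnion]
  exact ⟨l, Finset.mem_univ _, TM2.stmts₁_self⟩

/-- The statement at a label. -/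
def ProgStmt.ofLabel (l : Option M.Λ) : ProgStmt M :=
  ⟨l.map M.m, by
    cases l with
    | none => simp [TM2.stmts]
    | some l => exact mem_stmts_of_label l⟩

/-- The stack symbol represented by a symbol of the elementary machine. -/
def decodeSym (k : M.K) : MicroSym M → Option (M.Γ k)
  | .inl (⟨some (.push k' f _), _⟩, v) => if h : k' = k then some (h ▸ f v) else none
  | .inl _ => none
  | .inr a => if h : M.k₀ = k then some (h ▸ a) else none

theorem mem_stmts_of_mem {s s' : TM2.Stmt M.Γ M.Λ M.σ}
    (hs : some s ∈ TM2.stmts M.m (@Finset.univ M.Λ M.ΛFin)) (h : s' ∈ TM2.stmts₁ s) :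
    some s' ∈ TM2.stmts M.m (@Finset.univ M.Λ M.ΛFin) :=
  TM2.stmts_trans h hs

open Classical in
/-- The program of the elementary machine; `yes` is the symbol on top of the output stack that
signals acceptance. -/
noncomputable def microProg (yes : M.Γ M.k₁) :
    MicroState M → Instr M.K (MicroSym M) (MicroState M)
  | .inr _ => .idle
  | .inl (⟨none, _⟩, _) =>
      .read true M.k₁ fun o => .inr (decide (o.bind (decodeSym M.k₁) = some yes))
  | .inl (⟨some (.push k f s), h⟩, v) =>
      .push k (.inl (⟨some (.push k f s), h⟩, v))
        (.inl (⟨some s, mem_stmts_of_mem h (by simp [TM2.stmts₁, TM2.stmts₁_self])⟩, v))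
  | .inl (⟨some (.peek k f s), h⟩, v) =>
      .read false k fun o => .inl (⟨some s, mem_stmts_of_mem h
        (by simp [TM2.stmts₁, TM2.stmts₁_self])⟩, f v (o.bind (decodeSym k)))
  | .inl (⟨some (.pop k f s), h⟩, v) =>
      .read true k fun o => .inl (⟨some s, mem_stmts_of_mem h
        (by simp [TM2.stmts₁, TM2.stmts₁_self])⟩, f v (o.bind (decodeSym k)))
  | .inl (⟨some (.load f s), h⟩, v) =>
      -- A read that neither removes nor uses the symbol serves as a step without effect on the
      -- stacks; the choice of stack is immaterial.
      .read false M.k₀ fun _ => .inl (⟨some s, mem_stmts_of_mem h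
        (by simp [TM2.stmts₁, TM2.stmts₁_self])⟩, f v)
  | .inl (⟨some (.branch f s s'), h⟩, v) =>
      .read false M.k₀ fun _ => .inl (if f v then ⟨some s, mem_stmts_of_mem h
        (by simp [TM2.stmts₁, TM2.stmts₁_self])⟩ else ⟨some s', mem_stmts_of_mem h
        (by simp [TM2.stmts₁, TM2.stmts₁_self])⟩, v)
  | .inl (⟨some (.goto f), _⟩, v) =>
      .read false M.k₀ fun _ => .inl (ProgStmt.ofLabel (some (f v)), v)
  | .inl (⟨some .halt, _⟩, v) =>
      .read false M.k₀ fun _ => .inl (ProgStmt.ofLabel none, v)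

/-- The stacks `T` of the elementary machine represent the stacks `S`. -/
def Represents (T : M.K → List (MicroSym M)) (S : ∀ k, List (M.Γ k)) : Prop :=
  ∀ k, (T k).map (decodeSym k) = (S k).map some

theorem Represents.head? {T : M.K → List (MicroSym M)} {S : ∀ k, List (M.Γ k)}
    (h : Represents T S) (k : M.K) : (T k).head?.bind (decodeSym k) = (S k).head? := by
  have := h k
  cases hT : T k <;> cases hS : S k <;> simp_all

theorem Represents.tail {T : M.K → List (MicroSym M)} {S : ∀ k, List (M.Γ k)}
    (h : Represents T S) (k : M.K) :
    Represents (Function.update T k (T k).tail) (Function.update S k (S k).tail) := by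
  intro k'
  by_cases hk : k' = k
  · subst hk
    simp [h k', List.map_tail]
  · simp [hk, h k']

theorem Represents.push {T : M.K → List (MicroSym M)} {S : ∀ k, List (M.Γ k)}
    (h : Represents T S) (k : M.K) {a : MicroSym M} {b : M.Γ k} (hab : decodeSym k a = some b) :
    Represents (Function.update T k (a :: T k)) (Function.update S k (b :: S k)) := by
  intro i
  by_cases hk : i = k
  · subst hk
    simp [h i, hab]
  · simp [hk, h i]

/-- The number of instructions on the longest branch of a statement. -/
def stmtHeight {K : Type} {Γ : K → Type} {Λ σ : Type} : TM2.Stmt Γ Λ σ → ℕ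
  | .push _ _ s => stmtHeight s + 1
  | .peek _ _ s => stmtHeight s + 1
  | .pop _ _ s => stmtHeight s + 1
  | .load _ s => stmtHeight s + 1
  | .branch _ s s' => max (stmtHeight s) (stmtHeight s') + 1
  | .goto _ => 1
  | .halt => 1

/-- Each constructor of a statement costs exactly one elementary instruction, so the branch that is
taken bounds the time by the height. -/
theorem microRun_stmt (yes : M.Γ M.k₁) (s : TM2.Stmt M.Γ M.Λ M.σ)
    (hs : some s ∈ TM2.stmts M.m (@Finset.univ M.Λ M.ΛFin)) (v : M.σ)
    (T : M.K → List (MicroSym M)) (S : ∀ k, List (M.Γ k)) (hT : Represents T S) :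
    ∃ t ≤ stmtHeight s, ∃ T', Represents T' (TM2.stepAux s v S).stk ∧
      microRun (microProg yes) (.inl (⟨some s, hs⟩, v), T) t =
        (.inl (ProgStmt.ofLabel (TM2.stepAux s v S).l, (TM2.stepAux s v S).var), T') := by
  induction s generalizing v T S with
  | push k f s ih =>
    obtain ⟨t, ht, T', h, hr⟩ := ih (mem_stmts_of_mem hs (by simp [TM2.stmts₁, TM2.stmts₁_self]))
      v _ _ (hT.push k (a := .inl (⟨some (.push k f s), hs⟩, v)) (b := f v) (by simp [decodeSym]))
    refine ⟨1 + t, by simp only [stmtHeight]; omega, T', h, ?_⟩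
    rw [microRun_add]
    exact hr
  | peek k f s ih =>
    obtain ⟨t, ht, T', h, hr⟩ := ih (mem_stmts_of_mem hs (by simp [TM2.stmts₁, TM2.stmts₁_self]))
      (f v (S k).head?) _ _ hT
    refine ⟨1 + t, by simp only [stmtHeight]; omega, T', h, ?_⟩
    rw [microRun_add]
    refine Eq.trans ?_ hr
    rw [← hT.head?]
    rfl
  | pop k f s ih =>
    obtain ⟨t, ht, T', h, hr⟩ := ih (mem_stmts_of_mem hs (by simp [TM2.stmts₁, TM2.stmts₁_self]))
      (f v (S k).head?) _ _ (hT.tail k)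
    refine ⟨1 + t, by simp only [stmtHeight]; omega, T', h, ?_⟩
    rw [microRun_add]
    refine Eq.trans ?_ hr
    rw [← hT.head?]
    rfl
  | load f s ih =>
    obtain ⟨t, ht, T', h, hr⟩ := ih (mem_stmts_of_mem hs (by simp [TM2.stmts₁, TM2.stmts₁_self]))
      (f v) _ _ hT
    refine ⟨1 + t, by simp only [stmtHeight]; omega, T', h, ?_⟩
    rw [microRun_add]
    exact hr
  | branch f s s' ih ih' =>
    cases hf : f v with
    | true =>
      obtain ⟨t, ht, T', h, hr⟩ := ih
        (mem_stmts_of_mem hs (by simp [TM2.stmts₁, TM2.stmts₁_self])) v _ _ hT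
      refine ⟨1 + t, by simp only [stmtHeight]; omega, T', ?_, ?_⟩
      · simpa [hf] using h
      rw [microRun_add]
      simp only [TM2.stepAux, hf, cond_true]
      refine Eq.trans ?_ hr
      simp [microRun, microStep, microProg, hf]
    | false =>
      obtain ⟨t, ht, T', h, hr⟩ := ih'
        (mem_stmts_of_mem hs (by simp [TM2.stmts₁, TM2.stmts₁_self])) v _ _ hT
      refine ⟨1 + t, by simp only [stmtHeight]; omega, T', ?_, ?_⟩
      · simpa [hf] using h
      rw [microRun_add]
      simp only [TM2.stepAux, hf, cond_false]
      refine Eq.trans ?_ hr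
      simp [microRun, microStep, microProg, hf]
  | goto f => exact ⟨1, le_rfl, T, hT, rfl⟩
  | halt => exact ⟨1, le_rfl, T, hT, rfl⟩

/-- A program has finitely many labels, so a uniform `C` exists and the slowdown is a constant
factor. -/
theorem microRun_steps (yes : M.Γ M.k₁) (C : ℕ) (hC : ∀ l, stmtHeight (M.m l) ≤ C) (n : ℕ) :
    ∀ (c c' : M.Cfg) (T : M.K → List (MicroSym M)), Represents T c.stk →
      (flip bind M.step)^[n] (some c) = some c' →
      ∃ t ≤ C * n, ∃ T', Represents T' c'.stk ∧
        microRun (microProg yes) (.inl (ProgStmt.ofLabel c.l, c.var), T) t =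
          (.inl (ProgStmt.ofLabel c'.l, c'.var), T') := by
  induction n with
  | zero =>
    rintro c c' T hT h
    obtain rfl : c = c' := by simpa using h
    exact ⟨0, by simp, T, hT, rfl⟩
  | succ n ih =>
    rintro ⟨l, v, S⟩ c' T hT h
    cases l with
    | none =>
      rw [Function.iterate_succ_apply] at h
      -- A halted machine has no successor, and an undefined configuration stays undefined; so it
      -- cannot reach `c'` in a positive number of steps.
      have hn : ∀ n, (flip bind M.step)^[n] none = none := by
        intro n
        induction n with
        | zero => rfl
        | succ n ih => rw [Function.iterate_succ_apply', ih]; rfl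
      have h' : (flip bind M.step)^[n] none = some c' := h
      rw [hn] at h'
      cases h'
    | some l =>
      rw [Function.iterate_succ_apply] at h
      obtain ⟨t, ht, T', hT', hr⟩ := microRun_stmt yes (M.m l) (mem_stmts_of_label l) v T S hT
      obtain ⟨t', ht', T'', hT'', hr'⟩ := ih (TM2.stepAux (M.m l) v S) c' T' hT' h
      refine ⟨t + t', ?_, T'', hT'', ?_⟩
      · have := hC l
        rw [Nat.mul_succ]
        omega
      · rw [microRun_add, ← hr', ← hr]
        rfl

end Micro

-- Time bounds for elementary machines

/-- The initial stacks of a machine with input stack `k₀`. -/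
def initStacks {K A : Type} [DecidableEq K] (k₀ : K) (w : List A) : K → List A :=
  Function.update (fun _ => []) k₀ w

/-- The value at 1 is the sum of the coefficients, and every monomial is at most (n+1)^deg. The
resulting bound b(n+1)^d is easy to compute with counters and serves as the number of levels. -/
theorem polynomial_eval_le (p : Polynomial ℕ) (n : ℕ) :
    p.eval n ≤ p.eval 1 * (n + 1) ^ p.natDegree := by
  rw [Polynomial.eval_eq_sum_range, Polynomial.eval_eq_sum_range, Finset.sum_mul]
  refine Finset.sum_le_sum fun i hi => ?_
  rw [one_pow, mul_one]
  have hi : i ≤ p.natDegree := by simpa [Nat.lt_succ_iff] using hi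
  exact Nat.mul_le_mul_left _ ((Nat.pow_le_pow_left n.le_succ i).trans
    (Nat.pow_le_pow_right n.succ_pos hi))

/-- A constant slowdown and one additional step are absorbed by raising the top exponent by a
constant, since C + 2 < 2^(C+2). -/
theorem mul_twoExp_lt (C e : ℕ) : C * 2 ^ 2 ^ e + 1 < 2 ^ 2 ^ (e + (C + 2)) := by
  have h0 : 1 ≤ 2 ^ 2 ^ e := Nat.one_le_two_pow
  have h1 : C + 2 < 2 ^ (C + 2) := Nat.lt_two_pow_self
  have h3 : 2 ^ e + (C + 2) ≤ 2 ^ e * 2 ^ (C + 2) := by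
    have : 1 ≤ 2 ^ e := Nat.one_le_two_pow
    nlinarith
  calc C * 2 ^ 2 ^ e + 1 < 2 ^ 2 ^ e * (C + 2) := by nlinarith
    _ ≤ 2 ^ 2 ^ e * 2 ^ (C + 2) := Nat.mul_le_mul_left _ h1.le
    _ = 2 ^ (2 ^ e + (C + 2)) := by rw [← pow_add]
    _ ≤ 2 ^ (2 ^ e * 2 ^ (C + 2)) := Nat.pow_le_pow_right (by norm_num) h3
    _ = 2 ^ 2 ^ (e + (C + 2)) := by rw [pow_add 2 e]

/-- Languages in 2ExpTime are recognised by elementary stack machines in doubly exponential time. -/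
theorem InTwoExpTime.exists_micro {L : Language Bool} (hL : InTwoExpTime L) :
    ∃ (K A Q : Type) (_ : DecidableEq K) (_ : Fintype K) (_ : Fintype A) (_ : Fintype Q)
      (δ : Q → Instr K A Q) (k₀ : K) (inSym : Bool → A) (q₀ qacc : Q) (c d : ℕ), 0 < c ∧
      ∀ x : List Bool,
        (x ∈ L → ∃ t < 2 ^ 2 ^ (c * (x.length + 1) ^ d),
          (microRun δ (q₀, initStacks k₀ (x.map inSym)) t).1 = qacc) ∧
        ∀ t, (microRun δ (q₀, initStacks k₀ (x.map inSym)) t).1 = qacc → x ∈ L := by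
  classical
  obtain ⟨p, M, hp⟩ := hL
  let _ := M.tm.ΛFin
  let _ := M.tm.σFin
  let _ := M.tm.kFin
  let _ := M.tm.Γk₀Fin
  obtain ⟨C, hC⟩ : ∃ C, ∀ l, stmtHeight (M.tm.m l) ≤ C :=
    ⟨Finset.univ.sup fun l => stmtHeight (M.tm.m l),
      fun l => Finset.le_sup (f := fun l => stmtHeight (M.tm.m l)) (Finset.mem_univ l)⟩
  set yes := M.outputAlphabet.symm true with hyes
  refine ⟨M.tm.K, MicroSym M.tm, MicroState M.tm, inferInstance, inferInstance, inferInstance,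
    inferInstance, microProg yes, M.tm.k₀, fun b => .inr (M.inputAlphabet.symm b),
    .inl (ProgStmt.ofLabel (some M.tm.main), M.tm.initialState), .inr true,
    p.eval 1 + (C + 2), p.natDegree, by omega, fun x => ?_⟩
  have key : ∃ t < 2 ^ 2 ^ ((p.eval 1 + (C + 2)) * (x.length + 1) ^ p.natDegree),
      (microRun (microProg yes) (.inl (ProgStmt.ofLabel (some M.tm.main), M.tm.initialState),
        initStacks M.tm.k₀ (x.map fun b => .inr (M.inputAlphabet.symm b))) t).1 =
      .inr (decide (x ∈ L)) := by
    obtain ⟨⟨n, hn⟩, hle⟩ := M.outputsFun x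
    have hinit : Represents (initStacks M.tm.k₀ (x.map fun b => .inr (M.inputAlphabet.symm b)))
        (initList M.tm (x.map M.inputAlphabet.invFun)).stk := by
      intro k
      by_cases hk : k = M.tm.k₀
      · subst hk
        simp [initStacks, initList, decodeSym]
      · simp [initStacks, initList, hk]
    obtain ⟨t, ht, T', hT', hr⟩ := microRun_steps yes C hC n _ _ _ hinit hn
    -- The additional step inspects the output stack and turns its top symbol into a verdict.
    refine ⟨t + 1, ?_, ?_⟩
    · have h1 : C * n ≤ C * 2 ^ 2 ^ p.eval x.length :=
        Nat.mul_le_mul_left _ (hle.trans (hp _))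
      have h2 := mul_twoExp_lt C (p.eval x.length)
      have h3 : 2 ^ 2 ^ (p.eval x.length + (C + 2)) ≤
          2 ^ 2 ^ ((p.eval 1 + (C + 2)) * (x.length + 1) ^ p.natDegree) := by
        refine Nat.pow_le_pow_right (by norm_num) (Nat.pow_le_pow_right (by norm_num) ?_)
        rw [add_mul]
        exact add_le_add (polynomial_eval_le p _)
          (Nat.le_mul_of_pos_right _ (by positivity))
      omega
    · rw [microRun_succ]
      have hr' : microRun (microProg yes) (.inl (ProgStmt.ofLabel (some M.tm.main),
          M.tm.initialState), initStacks M.tm.k₀ (x.map fun b => .inr (M.inputAlphabet.symm b))) t =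
        (.inl (ProgStmt.ofLabel none, M.tm.initialState), T') := hr
      rw [hr']
      have hh := hT'.head? M.tm.k₁
      change Sum.inr (decide ((T' M.tm.k₁).head?.bind (decodeSym M.tm.k₁) = some yes)) = _
      rw [hh]
      simp [haltList, Computability.encodeBool, hyes]
  constructor
  · intro hx
    simpa [hx] using key
  · intro t ht
    by_contra hx
    obtain ⟨t', -, ht'⟩ := key
    -- Verdicts are permanent, so verdicts reached at times `t` and `t'` both persist to time `t +
    -- t'` and must agree there.
    have hs : ∀ c b s, (microRun (microProg yes) c s).1 = .inr b → ∀ s',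
        (microRun (microProg yes) c (s + s')).1 = .inr b := by
      intro c b s h s'
      rw [microRun_add, microRun_of_idle _ _ (by rw [h]; rfl), h]
    have h1 := hs _ _ t ht t'
    have h2 := hs _ _ t' ht' t
    rw [add_comm, h2] at h1
    simp [hx] at h1

set_option linter.unusedSectionVars false

/-! ### Names -/

/-- A name that encodes two numbers. -/
def pairName (m n : ℕ) : Name :=
  List.replicate m true ++ false :: List.replicate n true

theorem replicate_append_false_inj {m m' : ℕ} {l l' : List Bool}
    (h : List.replicate m true ++ false :: l = List.replicate m' true ++ false :: l') :
    m = m' ∧ l = l' := by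
  induction m generalizing m' with
  | zero => cases m' <;> simp_all [List.replicate_succ]
  | succ m ih =>
    cases m' with
    | zero => simp [List.replicate_succ] at h
    | succ m' =>
      simp only [List.replicate_succ, List.cons_append, List.cons.injEq, true_and] at h
      exact ⟨by rw [(ih h).1], (ih h).2⟩

theorem pairName_inj {m n m' n' : ℕ} : pairName m n = pairName m' n' ↔ m = m' ∧ n = n' := by
  constructor
  · intro h
    obtain ⟨h1, h2⟩ := replicate_append_false_inj h
    exact ⟨h1, by simpa using congrArg List.length h2⟩
  · rintro ⟨rfl, rfl⟩
    rfl

/-- The predicates of the reduction. On level `j` there is a linear order given by `dom j`, `min j`,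
`max j`, `suc j`, and `pair j` relates pairs of its elements to elements of level `j + 1`. The time
points are given by `tmin` and `tsuc`, the input word by `inp`, `start` and `nil`, and the machine
is described by `conf` and by the stack cells `node`. -/
inductive Sym (K A Q : Type) : Type
  | dom (j : ℕ)
  | min (j : ℕ)
  | max (j : ℕ)
  | suc (j : ℕ)
  | pair (j : ℕ)
  | tmin
  | tsuc
  | inp (b : Bool)
  | start
  | nil
  | node (k : K) (a : A)
  | conf (q : Q)

/-- Variables of the reduction: generic ones, one for each stack, and an existentially quantified
one for each level. -/
inductive Var (K : Type) : Type
  | v (i : ℕ)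
  | p (k : K)
  | ex (j : ℕ)

section Reduction

variable {K A Q : Type} [Fintype K] [Fintype A] [Fintype Q]

/-- The arity of a predicate. -/
def Sym.arity : Sym K A Q → ℕ
  | dom _ | min _ | max _ | tmin | start | nil => 1
  | suc _ | tsuc | inp _ | node _ _ => 2
  | pair _ => 3
  | conf _ => Fintype.card K + 1

/-- The kind of a predicate, as a number. -/
def Sym.tag : Sym K A Q → ℕ
  | dom _ => 0
  | min _ => 1
  | max _ => 2
  | suc _ => 3
  | pair _ => 4
  | tmin => 5
  | tsuc => 6
  | inp _ => 7
  | start => 8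
  | nil => 9
  | node _ _ => 10
  | conf _ => 11

/-- The number of a predicate among those of the same kind. -/
noncomputable def Sym.index : Sym K A Q → ℕ
  | dom j | min j | max j | suc j | pair j => j
  | tmin | tsuc | start | nil => 0
  | inp b => b.toNat
  | node k a => Fintype.equivFin (K × A) (k, a)
  | conf q => Fintype.equivFin Q q

/-- The name of a predicate. -/
noncomputable def Sym.name (s : Sym K A Q) : Name :=
  List.replicate s.arity true ++ false :: pairName s.tag s.index

theorem Sym.name_injective : Function.Injective (Sym.name : Sym K A Q → Name) := by
  intro s s' h
  have hb : ∀ b b' : Bool, b.toNat = b'.toNat → b = b' := by decide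
  obtain ⟨-, h⟩ := replicate_append_false_inj h
  obtain ⟨h1, h2⟩ := pairName_inj.1 h
  cases s <;> cases s' <;> simp [tag] at h1 <;> simp [index, Fin.val_inj] at h2 ⊢ <;>
    first | exact h2 | exact hb _ _ h2

theorem Sym.arity_pos (s : Sym K A Q) : 1 ≤ s.arity := by
  cases s <;> simp [arity]

/-- The kind of a variable, as a number. -/
def Var.tag : Var K → ℕ
  | v _ => 0
  | p _ => 1
  | ex _ => 2

/-- The number of a variable among those of the same kind. -/
noncomputable def Var.index : Var K → ℕ
  | v i => i
  | p k => Fintype.equivFin K k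
  | ex j => j

/-- The name of a variable. -/
noncomputable def Var.name (x : Var K) : Name :=
  pairName x.tag x.index

theorem Var.name_injective : Function.Injective (Var.name : Var K → Name) := by
  intro x x' h
  obtain ⟨h1, h2⟩ := pairName_inj.1 h
  cases x <;> cases x' <;> simp [tag] at h1 <;> simp [index, Fin.val_inj] at h2 ⊢ <;> exact h2

/-! ### Rules over abstract predicates and variables -/

/-- An atom over predicates and variables of the reduction. -/
abbrev SAtom (K A Q : Type) : Type := Sym K A Q × List (Var K)

/-- A TGD over predicates and variables of the reduction. -/
structure SRule (K A Q : Type) : Type where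
  body : List (SAtom K A Q)
  head : List (SAtom K A Q)

/-- The atom with names. -/
noncomputable def SAtom.toAtom (a : SAtom K A Q) : Atom Name :=
  ⟨a.1.name, a.2.map Var.name⟩

/-- The rule with names. -/
noncomputable def SRule.toRule (r : SRule K A Q) : Rule :=
  .tgd (r.body.map SAtom.toAtom) (r.head.map SAtom.toAtom)

/-- Truth of a TGD when the predicates are interpreted by `J`. -/
def SRule.Sat {D : Type} (J : Sym K A Q → List D → Prop) (r : SRule K A Q) : Prop :=
  ∀ σ : Var K → D, (∀ a ∈ r.body, J a.1 (a.2.map σ)) →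
    ∃ τ : Var K → D, (∀ a ∈ r.body, ∀ x ∈ a.2, τ x = σ x) ∧ ∀ a ∈ r.head, J a.1 (a.2.map τ)

theorem mem_argsOf_map_toAtom {l : List (SAtom K A Q)} {w : Name} :
    w ∈ argsOf (l.map SAtom.toAtom) ↔ ∃ a ∈ l, ∃ x ∈ a.2, x.name = w := by
  simp [argsOf, List.mem_flatMap, SAtom.toAtom]

theorem name_mem_argsOf {l : List (SAtom K A Q)} {x : Var K} :
    x.name ∈ argsOf (l.map SAtom.toAtom) ↔ ∃ a ∈ l, x ∈ a.2 := by
  rw [mem_argsOf_map_toAtom]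
  constructor
  · rintro ⟨a, ha, y, hy, h⟩
    exact ⟨a, ha, Var.name_injective h ▸ hy⟩
  · rintro ⟨a, ha, hx⟩
    exact ⟨a, ha, x, hx, rfl⟩

/-- Variable names are injective, so valuations of `Var K` extend to all names with arbitrary values
elsewhere. From here on, the semantics can be treated without names. -/
theorem SRule.satRule_iff {D : Type} [Nonempty D] (I : Interp D) (r : SRule K A Q) :
    I.SatRule r.toRule ↔ r.Sat fun s l => I.pred s.name l := by
  have hmap : ∀ (σ : Name → D) (a : SAtom K A Q),
      I.Holds (a.toAtom.map σ) ↔ I.pred a.1.name (a.2.map fun x => σ x.name) := by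
    intro σ a
    simp [Interp.Holds, Atom.map, SAtom.toAtom, Function.comp_def]
  have hext : ∀ σ : Var K → D, ∃ σ' : Name → D, ∀ x, σ' x.name = σ x := fun σ =>
    ⟨Function.extend Var.name σ fun _ => Classical.arbitrary D,
      fun x => Var.name_injective.extend_apply _ _ _⟩
  constructor
  · intro h σ hσ
    obtain ⟨σ', hσ'⟩ := hext σ
    obtain ⟨τ, h1, h2⟩ := h σ' (by
      intro a ha
      obtain ⟨b, hb, rfl⟩ := List.mem_map.1 ha
      rw [hmap]
      simpa [hσ'] using hσ b hb)
    refine ⟨fun x => τ x.name, fun a ha x hx => ?_, fun a ha => ?_⟩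
    · simp only [h1 x.name (name_mem_argsOf.2 ⟨a, ha, hx⟩), hσ']
    · exact (hmap τ a).1 (h2 _ (List.mem_map_of_mem ha))
  · intro h σ hσ
    obtain ⟨τ, h1, h2⟩ := h (fun x => σ x.name)
      fun a ha => (hmap σ a).1 (hσ _ (List.mem_map_of_mem ha))
    classical
    -- Body variables must keep the value under `σ`; on all other names the witness `τ` is used.
    refine ⟨fun w => if w ∈ argsOf (r.body.map SAtom.toAtom) then σ w else
      Function.extend Var.name τ (fun _ => Classical.arbitrary D) w, fun w hw => ?_,
      fun a ha => ?_⟩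
    · simp [hw]
    · obtain ⟨b, hb, rfl⟩ := List.mem_map.1 ha
      rw [hmap]
      refine (congrArg (I.pred b.1.name) (List.map_congr_left fun x hx => ?_)).mp (h2 b hb)
      split_ifs with hx'
      · obtain ⟨a, ha, hxa⟩ := name_mem_argsOf.1 hx'
        exact h1 a ha x hxa
      · exact (Var.name_injective.extend_apply _ _ _).symm

/-- Rules without existentially quantified variables. -/
def SRule.Full (r : SRule K A Q) : Prop :=
  ∀ a ∈ r.head, ∀ x ∈ a.2, ∃ b ∈ r.body, x ∈ b.2

/-- The witness agrees with `σ` on the body, which contains every variable of the head, so it may be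
replaced by `σ`. -/
theorem SRule.Full.sat_iff {D : Type} {J : Sym K A Q → List D → Prop} {r : SRule K A Q}
    (hr : r.Full) : r.Sat J ↔ ∀ σ : Var K → D, (∀ a ∈ r.body, J a.1 (a.2.map σ)) →
      ∀ a ∈ r.head, J a.1 (a.2.map σ) := by
  constructor
  · intro h σ hσ a ha
    obtain ⟨τ, h1, h2⟩ := h σ hσ
    have : a.2.map τ = a.2.map σ := List.map_congr_left fun x hx => by
      obtain ⟨b, hb, hxb⟩ := hr a ha x hx
      exact h1 b hb x hxb
    exact this ▸ h2 a ha
  · intro h σ hσ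
    exact ⟨σ, fun _ _ _ _ => rfl, h σ hσ⟩

/-! ### The rules of the reduction -/

/-- The rule that creates the elements of level `j + 1`. -/
def createRule (j : ℕ) : SRule K A Q :=
  ⟨[(.dom j, [.v 0]), (.dom j, [.v 1])], [(.pair j, [.v 0, .v 1, .ex j]), (.dom (j + 1), [.ex j])]⟩

/-- The rules that order level `j + 1` lexicographically. -/
def orderRules (j : ℕ) : List (SRule K A Q) :=
  [⟨[(.min j, [.v 0]), (.pair j, [.v 0, .v 0, .v 2])], [(.min (j + 1), [.v 2])]⟩,
   ⟨[(.max j, [.v 0]), (.pair j, [.v 0, .v 0, .v 2])], [(.max (j + 1), [.v 2])]⟩,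
   ⟨[(.suc j, [.v 1, .v 4]), (.pair j, [.v 0, .v 1, .v 2]), (.pair j, [.v 0, .v 4, .v 5])],
     [(.suc (j + 1), [.v 2, .v 5])]⟩,
   ⟨[(.suc j, [.v 0, .v 3]), (.max j, [.v 1]), (.min j, [.v 4]), (.pair j, [.v 0, .v 1, .v 2]),
      (.pair j, [.v 3, .v 4, .v 5])], [(.suc (j + 1), [.v 2, .v 5])]⟩]

/-- The rules that make level `k` the set of time points. -/
def topRules (k : ℕ) : List (SRule K A Q) :=
  [⟨[(.min k, [.v 0])], [(.tmin, [.v 0])]⟩,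
   ⟨[(.suc k, [.v 0, .v 1])], [(.tsuc, [.v 0, .v 1])]⟩]

/-- The atom that describes a configuration with state `q` and stack pointers `P` at time `t`. -/
noncomputable def confAtom (q : Q) (t : Var K) (P : K → Var K) : SAtom K A Q :=
  (.conf q, t :: Finset.univ.toList.map P)

variable [DecidableEq K]

open Classical in
/-- The rules that perform the instruction of the state `q`. -/
noncomputable def instrRules (q : Q) : Instr K A Q → List (SRule K A Q)
  | .push k a q' =>
    [⟨[confAtom q (.v 0) .p, (.tsuc, [.v 0, .v 1])],
      [confAtom q' (.v 1) (Function.update .p k (.v 1)), (.node k a, [.v 1, .p k])]⟩]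
  | .read rm k next =>
    ⟨[confAtom q (.v 0) .p, (.tsuc, [.v 0, .v 1]), (.nil, [.p k])],
      [confAtom (next none) (.v 1) .p]⟩ ::
    (Finset.univ : Finset A).toList.map fun a =>
      ⟨[confAtom q (.v 0) .p, (.tsuc, [.v 0, .v 1]), (.node k a, [.p k, .v 2])],
       [confAtom (next (some a)) (.v 1) (if rm then Function.update .p k (.v 2) else .p)]⟩
  | .idle => []

/-- The rules that set up the initial configuration. -/
noncomputable def initRules (k₀ : K) (inSym : Bool → A) (q₀ : Q) : List (SRule K A Q) :=
  [⟨[(.inp false, [.v 0, .v 1])], [(.node k₀ (inSym false), [.v 0, .v 1])]⟩,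
   ⟨[(.inp true, [.v 0, .v 1])], [(.node k₀ (inSym true), [.v 0, .v 1])]⟩,
   ⟨[(.start, [.v 0]), (.nil, [.v 1]), (.tmin, [.v 2])],
    [confAtom q₀ (.v 2) (Function.update (fun _ => .v 1) k₀ (.v 0))]⟩]

/-- The rules that depend on the machine only. -/
noncomputable def machineRules (δ : Q → Instr K A Q) (k₀ : K) (inSym : Bool → A) (q₀ : Q) :
    List (SRule K A Q) :=
  initRules k₀ inSym q₀ ++ (Finset.univ : Finset Q).toList.flatMap fun q => instrRules q (δ q)

/-- The rules for the levels below `k`, followed by the rules in `R`. -/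
def withLevels (R : List (SRule K A Q)) : ℕ → List (SRule K A Q)
  | 0 => R
  | k + 1 => createRule k :: (orderRules k ++ withLevels R k)

/-- The rule set of the reduction. -/
noncomputable def reductionRules (δ : Q → Instr K A Q) (k₀ : K) (inSym : Bool → A) (q₀ : Q)
    (k : ℕ) : List (SRule K A Q) :=
  topRules k ++ withLevels (machineRules δ k₀ inSym q₀) k

/-- The facts that do not depend on the input. -/
noncomputable def baseFacts (K A Q : Type) [Fintype K] [Fintype A] [Fintype Q] :
    List (Sym K A Q × List Name) :=
  [(.dom 0, [pairName 1 0]), (.dom 0, [pairName 1 1]), (.min 0, [pairName 1 0]),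
   (.max 0, [pairName 1 1]), (.suc 0, [pairName 1 0, pairName 1 1]), (.nil, [pairName 0 0])]

/-- The facts that describe an input word; a suffix of length `i` of the input is represented by
the constant `pairName 0 i`. -/
noncomputable def inputFacts : List Bool → List (Sym K A Q × List Name)
  | [] => baseFacts K A Q
  | b :: x => (.inp b, [pairName 0 (x.length + 1), pairName 0 x.length]) :: inputFacts x

/-- All facts. -/
noncomputable def reductionFacts (x : List Bool) : List (Sym K A Q × List Name) :=
  (.start, [pairName 0 x.length]) :: inputFacts x

/-- A fact with names. -/
noncomputable def toFact (a : Sym K A Q × List Name) : Atom Name :=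
  ⟨a.1.name, a.2⟩

/-- The instance of the entailment problem for a machine, an input word, and a number of levels. -/
noncomputable def reduction (δ : Q → Instr K A Q) (k₀ : K) (inSym : Bool → A) (q₀ qacc : Q)
    (k : ℕ) (x : List Bool) : Instance where
  rules := (reductionRules δ k₀ inSym q₀ k).map SRule.toRule
  facts := (reductionFacts (K := K) (A := A) (Q := Q) x).map toFact
  query := [SAtom.toAtom (confAtom (K := K) (A := A) qacc (.v 0) Var.p)]

end Reduction

section Reduction

variable {K A Q : Type} [Fintype K] [Fintype A] [Fintype Q]

/-! ### Well-formedness -/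

/-- Arguments of the predicate `s` are terms built from the function symbols of lower levels. -/
def Sym.level (k : ℕ) : Sym K A Q → ℕ
  | dom j | min j | max j | suc j => j
  | pair j => j + 1
  | tmin | tsuc | inp _ | start | nil | node _ _ | conf _ => k

/-- Rules without existentially quantified variables that never lower the level of a term. -/
structure SRule.Tame (k : ℕ) (r : SRule K A Q) : Prop where
  shared : ∃ a ∈ r.body, ∃ x ∈ a.2, ∃ b ∈ r.head, x ∈ b.2
  guarded : ∀ a ∈ r.head, ∀ x ∈ a.2, ∃ b ∈ r.body, x ∈ b.2 ∧ b.1.level k ≤ a.1.level k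
  not_ex : ∀ a ∈ r.body ++ r.head, ∀ x ∈ a.2, ∀ j, x ≠ .ex j
  arity : ∀ a ∈ r.body ++ r.head, a.2.length = a.1.arity

theorem SRule.Tame.full {k : ℕ} {r : SRule K A Q} (h : r.Tame k) : r.Full := fun a ha x hx =>
  let ⟨b, hb, hxb, _⟩ := h.guarded a ha x hx
  ⟨b, hb, hxb⟩

theorem tame_orderRules {j k : ℕ} {r : SRule K A Q} (hr : r ∈ orderRules j) : r.Tame k := by
  simp only [orderRules, List.mem_cons, List.not_mem_nil, or_false] at hr
  rcases hr with rfl | rfl | rfl | rfl <;> constructor <;> simp [Sym.level, Sym.arity]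

theorem tame_topRules {k : ℕ} {r : SRule K A Q} (hr : r ∈ topRules k) : r.Tame k := by
  simp only [topRules, List.mem_cons, List.not_mem_nil, or_false] at hr
  rcases hr with rfl | rfl <;> constructor <;> simp [Sym.level, Sym.arity]

theorem length_confAtom (q : Q) (t : Var K) (P : K → Var K) :
    (confAtom (A := A) q t P).2.length = (confAtom (A := A) q t P).1.arity := by
  simp [confAtom, Sym.arity]

theorem mem_confAtom {q : Q} {t x : Var K} {P : K → Var K} :
    x ∈ (confAtom (A := A) q t P).2 ↔ x = t ∨ ∃ k, P k = x := by
  simp [confAtom]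

variable [DecidableEq K]

theorem tame_initRules {k : ℕ} {k₀ : K} {inSym : Bool → A} {q₀ : Q} {r : SRule K A Q}
    (hr : r ∈ initRules k₀ inSym q₀) : r.Tame k := by
  simp only [initRules, List.mem_cons, List.not_mem_nil, or_false] at hr
  rcases hr with rfl | rfl | rfl
  · constructor <;> simp [Sym.level, Sym.arity]
  · constructor <;> simp [Sym.level, Sym.arity]
  · have hP : ∀ k', Function.update (fun _ => Var.v 1) k₀ (Var.v 0) k' = (Var.v 1 : Var K) ∨
        Function.update (fun _ => Var.v 1) k₀ (Var.v 0) k' = (Var.v 0 : Var K) := by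
      intro k'
      by_cases h : k' = k₀ <;> simp [h]
    constructor
    · exact ⟨(.tmin, [.v 2]), by simp, .v 2, by simp, _, List.mem_singleton_self _,
        mem_confAtom.2 (.inl rfl)⟩
    · intro a ha x hx
      obtain rfl := List.mem_singleton.1 ha
      rcases mem_confAtom.1 hx with rfl | ⟨k', rfl⟩
      · exact ⟨(.tmin, [.v 2]), by simp, by simp, le_rfl⟩
      · rcases hP k' with h | h <;> rw [h]
        · exact ⟨(.nil, [.v 1]), by simp, by simp, le_rfl⟩
        · exact ⟨(.start, [.v 0]), by simp, by simp, le_rfl⟩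
    · intro a ha x hx j
      simp only [List.cons_append, List.nil_append, List.mem_cons, List.not_mem_nil,
        or_false] at ha
      rcases ha with rfl | rfl | rfl | rfl
      · simp_all
      · simp_all
      · simp_all
      · rcases mem_confAtom.1 hx with rfl | ⟨k', rfl⟩
        · simp
        · rcases hP k' with h | h <;> simp [h]
    · intro a ha
      simp only [List.cons_append, List.nil_append, List.mem_cons, List.not_mem_nil,
        or_false] at ha
      rcases ha with rfl | rfl | rfl | rfl
      · rfl
      · rfl
      · rfl
      · exact length_confAtom _ _ _

/-- A rule whose body contains a configuration and a pair of consecutive time points is tame if the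
remaining atoms use appropriate variables. -/
theorem tame_stepRule {k : ℕ} {q q' : Q} {P : K → Var K} {B H : List (SAtom K A Q)}
    (hP : ∀ k', (∃ i, P k' = .v i) ∨ ∃ i, P k' = .p i)
    (hB : ∀ a ∈ B, a.2.length = a.1.arity ∧ a.1.level k ≤ k ∧
      ∀ x ∈ a.2, (∃ i, x = .v i) ∨ ∃ i, x = .p i)
    (hH : ∀ a ∈ H, a.2.length = a.1.arity ∧ a.1.level k = k ∧ ∀ x ∈ a.2, x = .v 1 ∨ ∃ i, x = .p i)
    (hPB : ∀ k' i, P k' = .v i → i = 1 ∨ ∃ a ∈ B, .v i ∈ a.2) :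
    (⟨confAtom q (.v 0) .p :: (.tsuc, [.v 0, .v 1]) :: B, confAtom q' (.v 1) P :: H⟩ :
      SRule K A Q).Tame k := by
  have h1 : ∃ b ∈ (confAtom q (.v 0) .p :: (.tsuc, [.v 0, .v 1]) :: B : List (SAtom K A Q)),
      Var.v 1 ∈ b.2 ∧ b.1.level k ≤ k := ⟨(.tsuc, [.v 0, .v 1]), by simp, by simp, le_rfl⟩
  have h2 : ∀ i, ∃ b ∈ (confAtom q (.v 0) .p :: (.tsuc, [.v 0, .v 1]) :: B : List (SAtom K A Q)),
      Var.p i ∈ b.2 ∧ b.1.level k ≤ k :=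
    fun i => ⟨_, List.mem_cons_self, mem_confAtom.2 (.inr ⟨i, rfl⟩), le_rfl⟩
  constructor
  · exact ⟨(.tsuc, [.v 0, .v 1]), by simp, .v 1, by simp, _, List.mem_cons_self,
      mem_confAtom.2 (.inl rfl)⟩
  · intro a ha x hx
    rcases List.mem_cons.1 ha with rfl | ha
    · rcases mem_confAtom.1 hx with rfl | ⟨k', rfl⟩
      · exact h1
      · rcases hP k' with ⟨i, hi⟩ | ⟨i, hi⟩ <;> rw [hi]
        · rcases hPB k' i hi with rfl | ⟨b, hb, hib⟩
          · exact h1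
          · exact ⟨b, by simp [hb], hib, (hB b hb).2.1⟩
        · exact h2 i
    · obtain ⟨-, hl, hv⟩ := hH a ha
      rw [hl]
      rcases hv x hx with rfl | ⟨i, rfl⟩
      · exact h1
      · exact h2 i
  · intro a ha x hx j
    simp only [List.cons_append, List.mem_cons, List.mem_append] at ha
    rcases ha with rfl | rfl | ha | rfl | ha
    · rcases mem_confAtom.1 hx with rfl | ⟨k', rfl⟩ <;> simp
    · simp only [List.mem_cons, List.not_mem_nil, or_false] at hx
      rcases hx with rfl | rfl <;> simp
    · rcases (hB a ha).2.2 x hx with ⟨i, rfl⟩ | ⟨i, rfl⟩ <;> simp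
    · rcases mem_confAtom.1 hx with rfl | ⟨k', rfl⟩
      · simp
      · rcases hP k' with ⟨i, hi⟩ | ⟨i, hi⟩ <;> simp [hi]
    · rcases (hH a ha).2.2 x hx with rfl | ⟨i, rfl⟩ <;> simp
  · intro a ha
    simp only [List.cons_append, List.mem_cons, List.mem_append] at ha
    rcases ha with rfl | rfl | ha | rfl | ha
    · exact length_confAtom _ _ _
    · rfl
    · exact (hB a ha).1
    · exact length_confAtom _ _ _
    · exact (hH a ha).1

theorem update_pointer (k : K) (i : ℕ) (k' : K) :
    (∃ j, Function.update Var.p k (.v i) k' = .v j ∧ j = i) ∨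
      ∃ j, Function.update Var.p k (.v i) k' = .p j := by
  by_cases h : k' = k <;> simp [h]

theorem tame_instrRules {k : ℕ} {q : Q} {ins : Instr K A Q} {r : SRule K A Q}
    (hr : r ∈ instrRules q ins) : r.Tame k := by
  cases ins with
  | push k' a q' =>
    obtain rfl := List.mem_singleton.1 hr
    refine tame_stepRule (fun k'' => ?_) (by simp) (by simp [Sym.level, Sym.arity])
      fun k'' i h => ?_
    · rcases update_pointer k' 1 k'' with ⟨j, h, -⟩ | h
      exacts [.inl ⟨j, h⟩, .inr h]
    · rcases update_pointer k' 1 k'' with ⟨j, h', rfl⟩ | ⟨j, h'⟩ <;> rw [h'] at h <;>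
        simp at h
      exact .inl h.symm
  | read rm k' next =>
    simp only [instrRules, List.mem_cons, List.mem_map] at hr
    rcases hr with rfl | ⟨a, -, rfl⟩
    · exact tame_stepRule (by simp) (by simp [Sym.level, Sym.arity]) (by simp) (by simp)
    · cases rm with
      | false => exact tame_stepRule (by simp) (by simp [Sym.level, Sym.arity]) (by simp) (by simp)
      | true =>
        refine tame_stepRule (fun k'' => ?_) (by simp [Sym.level, Sym.arity]) (by simp)
          fun k'' i h => ?_
        · rcases update_pointer k' 2 k'' with ⟨j, h, -⟩ | h
          exacts [.inl ⟨j, h⟩, .inr h]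
        · rcases update_pointer k' 2 k'' with ⟨j, h', rfl⟩ | ⟨j, h'⟩ <;>
            simp only [if_true] at h <;> rw [h'] at h <;> simp at h
          simp [← h]
  | idle => simp [instrRules] at hr

theorem mem_withLevels {R : List (SRule K A Q)} {k : ℕ} {r : SRule K A Q} :
    r ∈ withLevels R k ↔ r ∈ R ∨ ∃ j < k, r = createRule j ∨ r ∈ orderRules j := by
  induction k with
  | zero => simp [withLevels]
  | succ k ih =>
    simp only [withLevels, List.mem_cons, List.mem_append, ih, Nat.lt_succ_iff_lt_or_eq]
    constructor
    · rintro (h | h | h | ⟨j, hj, h⟩)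
      exacts [.inr ⟨k, .inr rfl, .inl h⟩, .inr ⟨k, .inr rfl, .inr h⟩, .inl h, .inr ⟨j, .inl hj, h⟩]
    · rintro (h | ⟨j, hj | rfl, h⟩)
      · exact .inr (.inr (.inl h))
      · exact .inr (.inr (.inr ⟨j, hj, h⟩))
      · rcases h with h | h
        exacts [.inl h, .inr (.inl h)]

variable {δ : Q → Instr K A Q} {k₀ : K} {inSym : Bool → A} {q₀ qacc : Q} {k : ℕ}

theorem mem_reductionRules {r : SRule K A Q} : r ∈ reductionRules δ k₀ inSym q₀ k ↔
    r ∈ topRules k ∨ r ∈ initRules k₀ inSym q₀ ∨ (∃ q, r ∈ instrRules q (δ q)) ∨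
      ∃ j < k, r = createRule j ∨ r ∈ orderRules j := by
  simp [reductionRules, mem_withLevels, machineRules, or_assoc]

theorem tame_or_create {r : SRule K A Q} (hr : r ∈ reductionRules δ k₀ inSym q₀ k) :
    r.Tame k ∨ ∃ j < k, r = createRule j := by
  rcases mem_reductionRules.1 hr with h | h | ⟨q, h⟩ | ⟨j, hj, h | h⟩
  exacts [.inl (tame_topRules h), .inl (tame_initRules h), .inl (tame_instrRules h),
    .inr ⟨j, hj, h⟩, .inl (tame_orderRules h)]

theorem arity_createRule (j : ℕ) :
    ∀ a ∈ (createRule j : SRule K A Q).body ++ (createRule j : SRule K A Q).head,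
      a.2.length = a.1.arity := by
  simp [createRule, Sym.arity]

theorem SRule.atoms_toRule (r : SRule K A Q) :
    r.toRule.atoms = (r.body ++ r.head).map SAtom.toAtom := by
  simp [SRule.toRule, Rule.atoms]

theorem mem_ruleAtoms {R : List (SRule K A Q)} {a : Atom Name} :
    a ∈ ruleAtoms (R.map SRule.toRule) ↔ ∃ r ∈ R, ∃ b ∈ r.body ++ r.head, b.toAtom = a := by
  simp only [ruleAtoms, List.mem_flatMap, List.mem_map, exists_exists_and_eq_and,
    SRule.atoms_toRule]

theorem wellFormed_toRule {r : SRule K A Q}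
    (h : ∃ a ∈ r.body, ∃ x ∈ a.2, ∃ b ∈ r.head, x ∈ b.2) : r.toRule.WellFormed := by
  obtain ⟨a, ha, x, hx, b, hb, hxb⟩ := h
  refine ⟨?_, ?_, ?_⟩
  · exact List.ne_nil_of_mem (List.mem_map_of_mem ha)
  · exact List.ne_nil_of_mem (List.mem_map_of_mem hb)
  · refine List.ne_nil_of_mem (a := x.name) ?_
    simp only [sharedVars, List.mem_filter, List.mem_dedup, decide_eq_true_eq]
    exact ⟨name_mem_argsOf.2 ⟨a, ha, hx⟩, name_mem_argsOf.2 ⟨b, hb, hxb⟩⟩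

theorem SRule.Tame.exVars_eq_nil {r : SRule K A Q} (h : r.Tame k) : r.toRule.exVars = [] := by
  simp only [SRule.toRule, Rule.exVars, List.filter_eq_nil_iff, decide_eq_true_eq, not_not]
  intro w hw
  obtain ⟨a, ha, x, hx, rfl⟩ := mem_argsOf_map_toAtom.1 hw
  exact name_mem_argsOf.2 (h.full a ha x hx)

theorem exVars_createRule {j : ℕ} {w : Name}
    (h : w ∈ (createRule j : SRule K A Q).toRule.exVars) : w = (Var.ex j : Var K).name := by
  simp only [SRule.toRule, Rule.exVars, List.mem_filter, decide_eq_true_eq] at h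
  obtain ⟨a, ha, x, hx, rfl⟩ := mem_argsOf_map_toAtom.1 h.1
  have h2 := h.2
  rw [name_mem_argsOf] at h2
  simp only [createRule, List.mem_cons, List.not_mem_nil, or_false] at ha h2
  rcases ha with rfl | rfl <;> simp at hx h2 <;> aesop

/-- Names begin with their arity in unary, so a single function on all names can recover it, as
well-formedness demands. -/
theorem takeWhile_name (s : Sym K A Q) : (s.name.takeWhile id).length = s.arity := by
  rw [Sym.name, List.takeWhile_append_of_pos (by simp)]
  simp

theorem length_inputFacts (x : List Bool) :
    ∀ a ∈ inputFacts (K := K) (A := A) (Q := Q) x, a.2.length = a.1.arity := by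
  induction x with
  | nil => simp [inputFacts, baseFacts, Sym.arity]
  | cons b x ih => simpa [inputFacts, Sym.arity] using ih

theorem sym_mem_inputFacts (x : List Bool) :
    ∀ a ∈ inputFacts (K := K) (A := A) (Q := Q) x,
      a.1 = .dom 0 ∨ a.1 = .min 0 ∨ a.1 = .max 0 ∨ a.1 = .suc 0 ∨ a.1 = .nil ∨
        ∃ b, a.1 = .inp b := by
  induction x with
  | nil => simp [inputFacts, baseFacts]
  | cons b x ih => simpa [inputFacts] using ih

theorem reduction_wellFormed (hk : 0 < k) (x : List Bool) :
    (reduction δ k₀ inSym q₀ qacc k x).WellFormed where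
  arity := by
    -- The maximum with 1 matters only for names that denote no predicate of the reduction.
    refine ⟨fun n => max 1 (n.takeWhile id).length, fun p => le_max_left _ _, fun a ha => ?_⟩
    have key : ∀ (s : Sym K A Q) (l : List Name), l.length = s.arity →
        (⟨s.name, l⟩ : Atom Name).args.length = max 1 ((s.name.takeWhile id).length) := by
      intro s l h
      rw [takeWhile_name, max_eq_right s.arity_pos]
      exact h
    simp only [List.mem_append, reduction] at ha
    rcases ha with (ha | ha) | ha
    · obtain ⟨r, hr, b, hb, rfl⟩ := mem_ruleAtoms.1 ha
      refine key _ _ ?_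
      rw [List.length_map]
      rcases tame_or_create hr with h | ⟨j, -, rfl⟩
      · exact h.arity b hb
      · exact arity_createRule j b hb
    · obtain ⟨b, hb, rfl⟩ := List.mem_map.1 ha
      refine key _ _ ?_
      rcases List.mem_cons.1 hb with rfl | hb
      · rfl
      · exact length_inputFacts x b hb
    · obtain rfl := List.mem_singleton.1 ha
      exact key _ _ (by rw [List.length_map]; exact length_confAtom _ _ _)
  rules_wf := by
    intro ρ hρ
    obtain ⟨r, hr, rfl⟩ := List.mem_map.1 hρ
    refine wellFormed_toRule ?_
    rcases tame_or_create hr with h | ⟨j, -, rfl⟩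
    · exact h.shared
    · exact ⟨(.dom j, [.v 0]), by simp [createRule], .v 0, by simp,
        (.pair j, [.v 0, .v 1, .ex j]), by simp [createRule], by simp⟩
  exVars_unique := by
    intro ρ hρ ρ' hρ' w hw hw'
    obtain ⟨r, hr, rfl⟩ := List.mem_map.1 hρ
    obtain ⟨r', hr', rfl⟩ := List.mem_map.1 hρ'
    rcases tame_or_create hr with h | ⟨j, -, rfl⟩
    · rw [h.exVars_eq_nil] at hw
      simp at hw
    -- Only creation rules have existential variables, and that of level `j` is `ex j`; a rule in
    -- which it reoccurs must be the same rule.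
    · obtain rfl := exVars_createRule hw
      rw [SRule.atoms_toRule, name_mem_argsOf] at hw'
      obtain ⟨a, ha, hja⟩ := hw'
      rcases tame_or_create hr' with h | ⟨j', -, rfl⟩
      · exact absurd rfl (h.not_ex a ha _ hja j)
      · have : j = j' := by
          simp only [createRule, List.cons_append, List.nil_append, List.mem_cons,
            List.not_mem_nil, or_false] at ha
          rcases ha with rfl | rfl | rfl | rfl <;> simp at hja <;> exact hja
        rw [this]
  facts_pred := by
    intro a ha
    obtain ⟨b, hb, rfl⟩ := List.mem_map.1 ha
    suffices h : ∃ r ∈ reductionRules δ k₀ inSym q₀ k, ∃ c ∈ r.body, c.1 = b.1 by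
      obtain ⟨r, hr, c, hc, hcb⟩ := h
      refine ⟨c.toAtom, mem_ruleAtoms.2 ⟨r, hr, c, List.mem_append_left _ hc, rfl⟩, ?_⟩
      simp [SAtom.toAtom, toFact, hcb]
    have ho : ∀ r ∈ orderRules 0, r ∈ reductionRules δ k₀ inSym q₀ k := fun r hr =>
      mem_reductionRules.2 (.inr (.inr (.inr ⟨0, hk, .inr hr⟩)))
    have hi : ∀ r ∈ initRules k₀ inSym q₀, r ∈ reductionRules δ k₀ inSym q₀ k := fun r hr =>
      mem_reductionRules.2 (.inr (.inl hr))
    have hb' : b.1 = .start ∨ b.1 = .dom 0 ∨ b.1 = .min 0 ∨ b.1 = .max 0 ∨ b.1 = .suc 0 ∨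
        b.1 = .nil ∨ ∃ c, b.1 = .inp c := by
      rcases List.mem_cons.1 hb with rfl | hb
      · exact .inl rfl
      · exact .inr (sym_mem_inputFacts x b hb)
    rcases hb' with h | h | h | h | h | h | ⟨c, h⟩ <;> rw [h]
    · exact ⟨_, hi _ (List.mem_of_getElem? (i := 2) rfl), (.start, [.v 0]), by simp, rfl⟩
    · exact ⟨_, mem_reductionRules.2 (.inr (.inr (.inr ⟨0, hk, .inl rfl⟩))), (.dom 0, [.v 0]),
        by simp [createRule], rfl⟩
    · exact ⟨_, ho _ (List.mem_of_getElem? (i := 0) rfl), (.min 0, [.v 0]), by simp, rfl⟩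
    · exact ⟨_, ho _ (List.mem_of_getElem? (i := 1) rfl), (.max 0, [.v 0]), by simp, rfl⟩
    · exact ⟨_, ho _ (List.mem_of_getElem? (i := 2) rfl), (.suc 0, [.v 1, .v 4]), by simp, rfl⟩
    · exact ⟨_, hi _ (List.mem_of_getElem? (i := 2) rfl), (.nil, [.v 1]), by simp, rfl⟩
    · cases c
      · exact ⟨_, hi _ (List.mem_of_getElem? (i := 0) rfl), (.inp false, [.v 0, .v 1]), by simp,
          rfl⟩
      · exact ⟨_, hi _ (List.mem_of_getElem? (i := 1) rfl), (.inp true, [.v 0, .v 1]), by simp,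
          rfl⟩
  query_ne := by simp [reduction]

/-! ### Acyclicity -/

theorem mem_subtermsList {s : GTerm} {ts : List GTerm} :
    s ∈ subtermsList ts ↔ ∃ t ∈ ts, s ∈ t.subterms := by
  induction ts with
  | nil => simp [subtermsList]
  | cons t ts ih => simp [subtermsList, ih]

theorem mem_symsList {w : Name} {ts : List GTerm} :
    w ∈ symsList ts ↔ ∃ t ∈ ts, w ∈ t.syms := by
  induction ts with
  | nil => simp [symsList]
  | cons t ts ih => simp [symsList, ih]

/-- Terms without cyclic subterms, built from the function symbols of levels below `j`. -/
def BelowLevel (K : Type) [Fintype K] (j : ℕ) (t : GTerm) : Prop :=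
  (∀ s ∈ t.subterms, ¬ s.Cyclic) ∧ ∀ w ∈ t.syms, ∃ i < j, w = (Var.ex i : Var K).name

theorem BelowLevel.mono {i j : ℕ} (h : i ≤ j) {t : GTerm} (ht : BelowLevel K i t) :
    BelowLevel K j t :=
  ⟨ht.1, fun w hw => let ⟨l, hl, e⟩ := ht.2 w hw; ⟨l, hl.trans_le h, e⟩⟩

theorem belowLevel_star (j : ℕ) : BelowLevel K j .star := by
  simp [BelowLevel, GTerm.subterms, GTerm.syms, GTerm.Cyclic]

/-- The new symbol has index `j`, while the arguments use only smaller indices; hence the new term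
is not cyclic. -/
theorem BelowLevel.app {j : ℕ} {ts : List GTerm} (h : ∀ t ∈ ts, BelowLevel K j t) :
    BelowLevel K (j + 1) (.app (Var.ex j : Var K).name ts) := by
  constructor
  · intro s hs
    rw [GTerm.subterms, List.mem_cons, mem_subtermsList] at hs
    rcases hs with rfl | ⟨t, ht, hs⟩
    · rintro ⟨t, ht, hw⟩
      obtain ⟨i, hi, e⟩ := (h t ht).2 _ hw
      have := Var.name_injective e
      simp only [Var.ex.injEq] at this
      omega
    · exact (h t ht).1 s hs
  · intro w hw
    rw [GTerm.syms, List.mem_cons, mem_symsList] at hw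
    rcases hw with rfl | ⟨t, ht, hw⟩
    · exact ⟨j, by omega, rfl⟩
    · exact ((h t ht).mono (Nat.le_succ j)).2 w hw

/-- The invariant behind acyclicity. Tame rules copy terms to predicates of the same or a higher
level. A creation rule, guarded by `dom j`, applies the symbol of `ex j` to terms of level `j` and
places the result at level `j + 1`. The closure under EGDs is vacuous. -/
theorem belowLevel_of_emfaSet {a : Atom GTerm}
    (h : EMFASet ((reductionRules δ k₀ inSym q₀ k).map SRule.toRule) a) :
    ∃ s : Sym K A Q, a.pred = s.name ∧ ∀ t ∈ a.args, BelowLevel K (s.level k) t := by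
  have hegd : ∀ β x y, Rule.egd β x y ∉ (reductionRules δ k₀ inSym q₀ k).map SRule.toRule := by
    intro β x y h
    obtain ⟨r, -, h⟩ := List.mem_map.1 h
    cases h
  induction h with
  | critical a h =>
    obtain ⟨r, hr, b, hb, rfl⟩ := mem_ruleAtoms.1 h
    refine ⟨b.1, rfl, fun t ht => ?_⟩
    obtain ⟨x, -, rfl⟩ := List.mem_map.1 ht
    exact belowLevel_star _
  | tgd β η h σ hβ a ha ih =>
    obtain ⟨r, hr, he⟩ := List.mem_map.1 h
    cases he
    obtain ⟨b, hb, rfl⟩ := List.mem_map.1 ha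
    refine ⟨b.1, rfl, fun t ht => ?_⟩
    have hbody : ∀ c ∈ r.body, ∀ x ∈ c.2, BelowLevel K (c.1.level k) (σ x.name) := by
      intro c hc x hx
      obtain ⟨s, hs, ht⟩ := ih _ (List.mem_map_of_mem hc)
      obtain rfl : c.1 = s := Sym.name_injective hs
      exact ht _ (List.mem_map_of_mem (List.mem_map_of_mem hx))
    obtain ⟨w, hw, rfl⟩ := List.mem_map.1 ht
    obtain ⟨x, hx, rfl⟩ := List.mem_map.1 hw
    rcases tame_or_create hr with hT | ⟨j, -, rfl⟩
    · obtain ⟨c, hc, hxc, hl⟩ := hT.guarded b hb x hx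
      rw [skolemSubst, if_pos (name_mem_argsOf.2 ⟨c, hc, hxc⟩)]
      exact (hbody c hc x hxc).mono hl
    · have h0 : ∀ x, (∃ c ∈ (createRule j : SRule K A Q).body, x ∈ c.2) →
          BelowLevel K j (σ x.name) := by
        rintro x ⟨c, hc, hx⟩
        have := hbody c hc x hx
        simp only [createRule, List.mem_cons, List.not_mem_nil, or_false] at hc
        rcases hc with rfl | rfl <;> exact this
      have hl : b.1.level k = j + 1 := by
        simp only [createRule, List.mem_cons, List.not_mem_nil, or_false] at hb
        rcases hb with rfl | rfl <;> rfl
      rw [hl, skolemSubst]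
      split_ifs with hm
      · exact (h0 x (name_mem_argsOf.1 hm)).mono (Nat.le_succ j)
      · have hex : x.name = (Var.ex j : Var K).name := by
          refine exVars_createRule (A := A) (Q := Q) ?_
          simp only [SRule.toRule, Rule.exVars, List.mem_filter, decide_eq_true_eq]
          exact ⟨name_mem_argsOf.2 ⟨b, hb, hx⟩, hm⟩
        rw [hex]
        -- The arguments of the Skolem term are values of shared variables, which occur in the body
        -- and are therefore guarded by `dom j`.
        refine BelowLevel.app fun t ht => ?_
        obtain ⟨w, hw, rfl⟩ := List.mem_map.1 ht
        simp only [sharedVars, List.mem_filter, List.mem_dedup] at hw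
        obtain ⟨c, hc, y, hy, rfl⟩ := mem_argsOf_map_toAtom.1 hw.1
        exact h0 y ⟨c, hc, hy⟩
  | egd_left β x y h => exact absurd h (hegd β x y)
  | egd_right β x y h => exact absurd h (hegd β x y)

theorem reduction_isEMFA (x : List Bool) :
    IsEMFA (reduction δ k₀ inSym q₀ qacc k x).rules := by
  intro a ha t ht
  obtain ⟨s, -, h⟩ := belowLevel_of_emfaSet ha
  exact (h t ht).1

end Reduction

section Reduction

variable {K A Q : Type} [Fintype K] [Fintype A] [Fintype Q] [DecidableEq K]
variable {δ : Q → Instr K A Q} {k₀ : K} {inSym : Bool → A} {q₀ qacc : Q} {k : ℕ}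

/-! ### Every model simulates the machine -/

/-- The size of the linear order on level `j`. -/
def orderSize (j : ℕ) : ℕ := 2 ^ 2 ^ j

theorem orderSize_succ (j : ℕ) : orderSize (j + 1) = orderSize j * orderSize j := by
  rw [orderSize, orderSize, ← pow_add, pow_succ, mul_two]

theorem one_lt_orderSize (j : ℕ) : 1 < orderSize j :=
  Nat.one_lt_pow (by positivity) (by norm_num)

/-- The valuation given by a list of values for the generic variables and by `P` for the variables
of the stacks. -/
def valuation {D : Type} (l : List D) (d : D) (P : K → D) : Var K → D
  | .v i => l.getD i d
  | .p k => P k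
  | .ex _ => d

/-- The elements `e 0, e 1, …` form the linear order on level `j`. -/
structure IsOrder {D : Type} (J : Sym K A Q → List D → Prop) (j : ℕ) (e : ℕ → D) : Prop where
  dom : ∀ i < orderSize j, J (.dom j) [e i]
  min : J (.min j) [e 0]
  max : J (.max j) [e (orderSize j - 1)]
  suc : ∀ i, i + 1 < orderSize j → J (.suc j) [e i, e (i + 1)]

theorem SRule.Tame.apply {D : Type} {J : Sym K A Q → List D → Prop} {r : SRule K A Q}
    (hr : r.Tame k) (hs : r.Sat J) (σ : Var K → D) (h : ∀ a ∈ r.body, J a.1 (a.2.map σ)) :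
    ∀ a ∈ r.head, J a.1 (a.2.map σ) :=
  hr.full.sat_iff.1 hs σ h

/-- With N elements on level `j`, the pair of `e a` and `e b` represents the number aN + b. The
lexicographic successor either increments the low digit or carries. Distinctness of the elements is
neither claimed nor needed. -/
theorem IsOrder.exists_succ {D : Type} {J : Sym K A Q → List D → Prop} {j : ℕ} {e : ℕ → D}
    (he : IsOrder J j e) (hc : (createRule j).Sat J) (ho : ∀ r ∈ orderRules j, r.Sat J) :
    ∃ e', IsOrder J (j + 1) e' := by
  have hN := one_lt_orderSize j
  set N := orderSize j with hNdef
  -- The bounds are placed under the existential so that `z` can be chosen as a total function; out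
  -- of range its value is irrelevant.
  have hpair : ∀ a b, ∃ z, a < N → b < N →
      J (.pair j) [e a, e b, z] ∧ J (.dom (j + 1)) [z] := by
    intro a b
    by_cases hab : a < N ∧ b < N
    · obtain ⟨τ, h1, h2⟩ := hc (valuation [e a, e b] (e a) fun _ => e a) (by
        simp [createRule, valuation, he.dom a hab.1, he.dom b hab.2])
      refine ⟨τ (.ex j), fun _ _ => ?_⟩
      have e0 : τ (.v 0) = e a :=
        (h1 (.dom j, [.v 0]) (by simp [createRule]) (.v 0) (by simp)).trans
        (by simp [valuation])
      have e1 : τ (.v 1) = e b :=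
        (h1 (.dom j, [.v 1]) (by simp [createRule]) (.v 1) (by simp)).trans
        (by simp [valuation])
      simpa [createRule, e0, e1] using h2
    · exact ⟨e a, fun h h' => absurd ⟨h, h'⟩ hab⟩
  choose z hz using hpair
  have hemax : J (.max j) [e (N - 1)] := he.max
  have hmin := ho _ (List.mem_of_getElem? (i := 0) rfl)
  have hmax := ho _ (List.mem_of_getElem? (i := 1) rfl)
  have hs1 := ho _ (List.mem_of_getElem? (i := 2) rfl)
  have hs2 := ho _ (List.mem_of_getElem? (i := 3) rfl)
  have tame : ∀ (i : ℕ) (r : SRule K A Q), (orderRules j)[i]? = some r → r.Tame 0 :=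
    fun i r h => tame_orderRules (List.mem_of_getElem? h)
  -- The index `i` is split into its two digits in base N.
  refine ⟨fun i => z (i / N) (i % N), ?_, ?_, ?_, ?_⟩
  · intro i hi
    rw [orderSize_succ] at hi
    exact (hz _ _ (Nat.div_lt_of_lt_mul hi) (Nat.mod_lt _ (by omega))).2
  · have := (tame 0 _ rfl).apply hmin (valuation [e 0, e 0, z 0 0] (e 0) fun _ => e 0) (by
      simpa [valuation, he.min] using (hz 0 0 (by omega) (by omega)).1)
    simpa [valuation] using this
  · have := (tame 1 _ rfl).apply hmax
      (valuation [e (N - 1), e 0, z (N - 1) (N - 1)] (e 0) fun _ => e 0) (by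
      simpa [valuation, hemax] using (hz (N - 1) (N - 1) (by omega) (by omega)).1)
    have h1 : (orderSize (j + 1) - 1) = N * (N - 1) + (N - 1) := by
      rw [orderSize_succ]
      obtain ⟨m, hm⟩ : ∃ m, N = m + 1 := ⟨N - 1, by omega⟩
      rw [← hNdef, hm]
      simp only [Nat.add_sub_cancel]
      have : (m + 1) * (m + 1) = (m + 1) * m + m + 1 := by ring
      omega
    have h2 : (orderSize (j + 1) - 1) / N = N - 1 := by
      rw [h1, Nat.mul_add_div (by omega), Nat.div_eq_of_lt (by omega), add_zero]
    have h3 : (orderSize (j + 1) - 1) % N = N - 1 := by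
      rw [h1, Nat.mul_add_mod, Nat.mod_eq_of_lt (by omega)]
    simp only [h2, h3]
    simpa [valuation] using this
  · intro i hi
    rw [orderSize_succ, ← hNdef] at hi
    have hq : i / N < N := Nat.div_lt_of_lt_mul (by omega)
    have hm : i % N < N := Nat.mod_lt _ (by omega)
    have hi' : N * (i / N) + i % N = i := Nat.div_add_mod i N
    by_cases hlt : i % N + 1 < N
    · have e1 : (i + 1) / N = i / N := by
        rw [show i + 1 = N * (i / N) + (i % N + 1) by omega, Nat.mul_add_div (by omega),
          Nat.div_eq_of_lt hlt, add_zero]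
      have e2 : (i + 1) % N = i % N + 1 := by
        rw [show i + 1 = N * (i / N) + (i % N + 1) by omega, Nat.mul_add_mod,
          Nat.mod_eq_of_lt hlt]
      have := (tame 2 _ rfl).apply hs1 (valuation [e (i / N), e (i % N), z (i / N) (i % N), e 0,
        e (i % N + 1), z (i / N) (i % N + 1)] (e 0) fun _ => e 0) (by
        simpa [valuation, he.suc _ hlt] using ⟨(hz _ _ hq hm).1, (hz _ _ hq hlt).1⟩)
      simp only [e1, e2]
      simpa [valuation] using this
    · have hmN : i % N = N - 1 := by omega
      have hi2 : i + 1 = N * (i / N + 1) := by rw [mul_add]; omega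
      have e1 : (i + 1) / N = i / N + 1 := by
        rw [hi2, Nat.mul_div_cancel_left _ (by omega)]
      have e2 : (i + 1) % N = 0 := by
        rw [hi2, Nat.mul_mod_right]
      have hq' : i / N + 1 < N := by
        rw [hi2] at hi
        exact lt_of_mul_lt_mul_left hi (Nat.zero_le _)
      have := (tame 3 _ rfl).apply hs2 (valuation [e (i / N), e (N - 1), z (i / N) (N - 1),
        e (i / N + 1), e 0, z (i / N + 1) 0] (e 0) fun _ => e 0) (by
        simpa [valuation, he.suc _ hq', he.min, hemax] using
          ⟨(hz _ _ hq (by omega)).1, (hz _ _ hq' (by omega)).1⟩)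
      simp only [e1, e2, hmN]
      simpa [valuation] using this

/-- The pointer `d` represents the contents `l` of the stack `k`. -/
def Points {D : Type} (J : Sym K A Q → List D → Prop) (k : K) : D → List A → Prop
  | d, [] => J .nil [d]
  | d, a :: l => ∃ e, J (.node k a) [d, e] ∧ Points J k e l

/-- An atom that describes a configuration, in a model. -/
def HoldsConf {D : Type} (J : Sym K A Q → List D → Prop) (q : Q) (t : D) (P : K → D) : Prop :=
  J (.conf q) (t :: Finset.univ.toList.map P)

theorem holds_confAtom {D : Type} {J : Sym K A Q → List D → Prop} {q : Q} {t : Var K}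
    {P : K → Var K} {σ : Var K → D} :
    J (confAtom (A := A) q t P).1 ((confAtom (A := A) q t P).2.map σ) ↔
      HoldsConf J q (σ t) fun k => σ (P k) := by
  simp [confAtom, HoldsConf, Function.comp_def]

/-- Cells are never changed, since `node` atoms only accumulate, so the pointers of untouched stacks
stay valid. A push makes `t'` the new top cell, and a removing read follows the link stored in the
top cell. -/
theorem points_step {D : Type} {J : Sym K A Q → List D → Prop} {c : Q × (K → List A)}
    (hr : ∀ r ∈ instrRules c.1 (δ c.1), r.Sat J) (hidle : δ c.1 ≠ .idle) {t t' : D} {P : K → D}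
    (hc : HoldsConf J c.1 t P) (hP : ∀ k, Points J k (P k) (c.2 k)) (ht : J .tsuc [t, t']) :
    ∃ P', HoldsConf J (microStep δ c).1 t' P' ∧ ∀ k, Points J k (P' k) ((microStep δ c).2 k) := by
  have tame : ∀ r ∈ instrRules c.1 (δ c.1), r.Tame 0 := fun r h => tame_instrRules h
  unfold microStep
  cases hδ : δ c.1 with
  | idle => exact absurd hδ hidle
  | push k a q' =>
    rw [hδ] at hr tame
    have := (tame _ (List.mem_singleton_self _)).apply (hr _ (List.mem_singleton_self _))
      (valuation [t, t'] t P) (by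
        intro b hb
        simp only [List.mem_cons, List.not_mem_nil, or_false] at hb
        rcases hb with rfl | rfl
        · exact holds_confAtom.2 hc
        · simpa [valuation] using ht)
    have h1 := holds_confAtom.1 (this _ List.mem_cons_self)
    have h2 := this _ (List.mem_cons_of_mem _ (List.mem_singleton_self _))
    refine ⟨Function.update P k t', ?_, fun k' => ?_⟩
    · refine (congrArg (HoldsConf J q' t') ?_).mp h1
      funext k'
      by_cases hk : k' = k
      · subst hk; simp [valuation]
      · simp [hk, valuation]
    · by_cases hk : k' = k
      · subst hk
        simp only [Function.update_self]
        exact ⟨P k', h2, hP k'⟩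
      · simpa [hk] using hP k'
  | read rm k next =>
    rw [hδ] at hr tame
    have hPk := hP k
    change ∃ P', HoldsConf J (next (c.2 k).head?) t' P' ∧ ∀ k', Points J k' (P' k')
      ((if rm then Function.update c.2 k (c.2 k).tail else c.2) k')
    cases hl : c.2 k with
    | nil =>
      rw [hl] at hPk
      have := (tame _ List.mem_cons_self).apply (hr _ List.mem_cons_self)
        (valuation [t, t'] t P) (by
          intro b hb
          simp only [List.mem_cons, List.not_mem_nil, or_false] at hb
          rcases hb with rfl | rfl | rfl
          · exact holds_confAtom.2 hc
          · simpa [valuation] using ht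
          · exact hPk)
      refine ⟨P, holds_confAtom.1 (this _ List.mem_cons_self), fun k' => ?_⟩
      have : (if rm then Function.update c.2 k (c.2 k).tail else c.2) k' = c.2 k' := by
        by_cases hk : k' = k
        · subst hk; cases rm <;> simp [hl]
        · cases rm <;> simp [hk]
      rw [hl] at this
      rw [this]
      exact hP k'
    | cons a l =>
      rw [hl] at hPk
      obtain ⟨d', hd, hd'⟩ := hPk
      have hmem := List.mem_cons_of_mem
        (⟨[confAtom c.1 (.v 0) .p, (.tsuc, [.v 0, .v 1]), (.nil, [.p k])],
          [confAtom (next none) (.v 1) .p]⟩ : SRule K A Q)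
        (List.mem_map_of_mem (f := fun a : A => (⟨[confAtom c.1 (.v 0) .p,
          (.tsuc, [.v 0, .v 1]), (.node k a, [.p k, .v 2])], [confAtom (next (some a)) (.v 1)
            (if rm then Function.update .p k (.v 2) else .p)]⟩ : SRule K A Q))
        (Finset.mem_toList.2 (Finset.mem_univ a)))
      have := (tame _ hmem).apply (hr _ hmem) (valuation [t, t', d'] t P) (by
          intro b hb
          simp only [List.mem_cons, List.not_mem_nil, or_false] at hb
          rcases hb with rfl | rfl | rfl
          · exact holds_confAtom.2 hc
          · simpa [valuation] using ht
          · simpa [valuation] using hd)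
      have h1 := holds_confAtom.1 (this _ List.mem_cons_self)
      refine ⟨_, h1, fun k' => ?_⟩
      cases rm with
      | false => exact hP k'
      | true =>
        by_cases hk : k' = k
        · subst hk; simpa [valuation] using hd'
        · simpa [hk, valuation] using hP k'

/-- The strict bound ensures that the order of level `k` still has an element for time `t`. -/
theorem entails_reduction {x : List Bool} {t : ℕ} (ht : t < orderSize k)
    (hacc : (microRun δ (q₀, initStacks k₀ (x.map inSym)) t).1 = qacc) :
    (reduction δ k₀ inSym q₀ qacc k x).Entails := by
  intro D _ I hrules hfacts
  set J : Sym K A Q → List D → Prop := fun s l => I.pred s.name l with hJ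
  have hsat : ∀ r ∈ reductionRules δ k₀ inSym q₀ k, r.Sat J := fun r hr =>
    (r.satRule_iff I).1 (hrules _ (List.mem_map_of_mem hr))
  have hf : ∀ a ∈ reductionFacts (K := K) (A := A) (Q := Q) x, J a.1 (a.2.map I.const) :=
    fun a ha => hfacts _ (List.mem_map_of_mem ha)
  have hbase : ∀ (y : List Bool), ∀ a ∈ baseFacts K A Q, a ∈ inputFacts y := by
    intro y a ha
    induction y with
    | nil => exact ha
    | cons b y ih => exact List.mem_cons_of_mem _ ih
  have hb : ∀ a ∈ baseFacts K A Q, J a.1 (a.2.map I.const) := fun a ha =>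
    hf a (List.mem_cons_of_mem _ (hbase x a ha))
  -- the time points
  have horder : ∀ j ≤ k, ∃ e, IsOrder J j e := by
    intro j
    induction j with
    | zero =>
      intro _
      have hN : orderSize 0 = 2 := by norm_num [orderSize]
      simp only [baseFacts, List.mem_cons, List.not_mem_nil, or_false, forall_eq_or_imp,
        forall_eq, List.map_cons, List.map_nil] at hb
      obtain ⟨h1, h2, h3, h4, h5, -⟩ := hb
      refine ⟨fun i => I.const (pairName 1 i), ?_, h3, ?_, ?_⟩
      · intro i hi
        rw [hN] at hi
        interval_cases i
        exacts [h1, h2]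
      · simpa [hN] using h4
      · intro i hi
        obtain rfl : i = 0 := by omega
        exact h5
    | succ j ih =>
      intro hj
      obtain ⟨e, he⟩ := ih (by omega)
      exact he.exists_succ
        (hsat _ (mem_reductionRules.2 (.inr (.inr (.inr ⟨j, by omega, .inl rfl⟩)))))
        fun r hr => hsat _ (mem_reductionRules.2 (.inr (.inr (.inr ⟨j, by omega, .inr hr⟩))))
  obtain ⟨e, he⟩ := horder k le_rfl
  have hmin : J .tmin [e 0] := by
    have hm := List.mem_of_getElem? (l := topRules (K := K) (A := A) (Q := Q) k) (i := 0) rfl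
    have := (tame_topRules hm).apply (hsat _ (mem_reductionRules.2 (.inl hm)))
      (valuation [e 0] (e 0) fun _ => e 0) (by simpa [valuation] using he.min)
    simpa [valuation] using this
  have hsuc : ∀ i, i + 1 < orderSize k → J .tsuc [e i, e (i + 1)] := by
    intro i hi
    have hm := List.mem_of_getElem? (l := topRules (K := K) (A := A) (Q := Q) k) (i := 1) rfl
    have := (tame_topRules hm).apply (hsat _ (mem_reductionRules.2 (.inl hm)))
      (valuation [e i, e (i + 1)] (e 0) fun _ => e 0) (by simpa [valuation] using he.suc i hi)
    simpa [valuation] using this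
  -- the input
  have hnil : J .nil [I.const (pairName 0 0)] := hb (.nil, [pairName 0 0]) (by simp [baseFacts])
  have hinp : ∀ (y : List Bool), (∀ a ∈ inputFacts (K := K) (A := A) (Q := Q) y,
      J a.1 (a.2.map I.const)) → Points J k₀ (I.const (pairName 0 y.length)) (y.map inSym) := by
    intro y
    induction y with
    | nil => exact fun _ => hnil
    | cons b y ih =>
      intro h
      refine ⟨I.const (pairName 0 y.length), ?_, ih fun a ha => h a (List.mem_cons_of_mem _ ha)⟩
      have h0 := h _ List.mem_cons_self
      cases b
      · have hm := List.mem_of_getElem? (l := initRules k₀ inSym q₀) (i := 0) rfl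
        have := (tame_initRules (k := 0) hm).apply
          (hsat _ (mem_reductionRules.2 (.inr (.inl hm))))
          (valuation [I.const (pairName 0 (y.length + 1)), I.const (pairName 0 y.length)]
            (e 0) fun _ => e 0) (by simpa [valuation] using h0)
        simpa [valuation] using this
      · have hm := List.mem_of_getElem? (l := initRules k₀ inSym q₀) (i := 1) rfl
        have := (tame_initRules (k := 0) hm).apply
          (hsat _ (mem_reductionRules.2 (.inr (.inl hm))))
          (valuation [I.const (pairName 0 (y.length + 1)), I.const (pairName 0 y.length)]
            (e 0) fun _ => e 0) (by simpa [valuation] using h0)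
        simpa [valuation] using this
  -- the run
  set c₀ : Q × (K → List A) := (q₀, initStacks k₀ (x.map inSym)) with hc₀
  -- Idle states have no rules, so the derived configuration stops advancing there; `s'` may then
  -- lag behind `s`, but the configuration itself no longer changes.
  have hrun : ∀ s < orderSize k, ∃ s' P, HoldsConf J (microRun δ c₀ s).1 (e s') P ∧
      (s' = s ∨ δ (microRun δ c₀ s).1 = .idle) ∧
      ∀ k', Points J k' (P k') ((microRun δ c₀ s).2 k') := by
    intro s
    induction s with
    | zero =>
      intro _
      have hm := List.mem_of_getElem? (l := initRules k₀ inSym q₀) (i := 2) rfl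
      have hstart : J .start [I.const (pairName 0 x.length)] := hf _ List.mem_cons_self
      have := (tame_initRules (k := 0) hm).apply (hsat _ (mem_reductionRules.2 (.inr (.inl hm))))
          (valuation [I.const (pairName 0 x.length), I.const (pairName 0 0), e 0]
            (e 0) fun _ => e 0) (by simp [valuation, hstart, hnil, hmin])
      refine ⟨0, _, holds_confAtom.1 (this _ List.mem_cons_self), .inl rfl, fun k' => ?_⟩
      by_cases hk : k' = k₀
      · subst hk
        simpa [microRun, hc₀, initStacks, valuation] using
          hinp x fun a ha => hf a (List.mem_cons_of_mem _ ha)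
      · simpa [microRun, hc₀, initStacks, valuation, hk, Points] using hnil
    | succ s ih =>
      intro hs
      obtain ⟨s', P, h1, h2, h3⟩ := ih (by omega)
      rw [microRun_succ]
      by_cases hidle : δ (microRun δ c₀ s).1 = .idle
      · have : microStep δ (microRun δ c₀ s) = microRun δ c₀ s := by
          rw [microStep, hidle]
        rw [this]
        exact ⟨s', P, h1, .inr hidle, h3⟩
      · obtain rfl : s' = s := h2.resolve_right hidle
        obtain ⟨P', h4, h5⟩ := points_step (fun r hr => hsat r
          (mem_reductionRules.2 (.inr (.inr (.inl ⟨_, hr⟩))))) hidle h1 h3 (hsuc s' hs)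
        exact ⟨s' + 1, P', h4, .inl rfl, h5⟩
  obtain ⟨s', P, h1, -⟩ := hrun t ht
  rw [hacc] at h1
  refine ⟨Function.extend Var.name (valuation [e s'] (e 0) P) fun _ => e 0, fun a ha => ?_⟩
  obtain rfl := List.mem_singleton.1 ha
  have h2 : J (confAtom (K := K) (A := A) qacc (.v 0) Var.p).1
      ((confAtom (K := K) (A := A) qacc (.v 0) Var.p).2.map (valuation [e s'] (e 0) P)) :=
    holds_confAtom.2 h1
  simpa [Interp.Holds, Atom.map, SAtom.toAtom, Function.comp_def,
    Var.name_injective.extend_apply] using h2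

/-! ### A model that faithfully describes the run of the machine -/

/-- The contents of the stack `k` represented by an element of the model: time points represent the
contents at that time, words represent the input. -/
def stackAt (k₀ : K) (inSym : Bool → A) (c : ℕ → Q × (K → List A)) (k : K) :
    ℕ ⊕ List Bool → List A
  | .inl t => (c t).2 k
  | .inr x => initStacks k₀ (x.map inSym) k

/-- The interpretation of the predicates in the model for the run `c` on the input `x`. -/
def runModel (k₀ : K) (inSym : Bool → A) (c : ℕ → Q × (K → List A)) (x : List Bool) :
    Sym K A Q → List (ℕ ⊕ List Bool) → Prop
  | .dom j, l => ∃ a, l = [.inl a] ∧ a < orderSize j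
  | .min _, l => l = [.inl 0]
  | .max j, l => ∃ a, l = [.inl a] ∧ a + 1 = orderSize j
  | .suc j, l => ∃ a, l = [.inl a, .inl (a + 1)] ∧ a + 1 < orderSize j
  | .pair j, l => ∃ a b, l = [.inl a, .inl b, .inl (a * orderSize j + b)] ∧ a < orderSize j ∧
      b < orderSize j
  | .tmin, l => l = [.inl 0]
  | .tsuc, l => ∃ a, l = [.inl a, .inl (a + 1)]
  | .inp b, l => ∃ y, l = [.inr (b :: y), .inr y]
  | .start, l => l = [.inr x]
  | .nil, l => ∃ d, l = [d] ∧ ∀ k, stackAt k₀ inSym c k d = []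
  | .node k a, l => ∃ d d', l = [d, d'] ∧ stackAt k₀ inSym c k d = a :: stackAt k₀ inSym c k d'
  | .conf q, l => ∃ t P, l = .inl t :: Finset.univ.toList.map P ∧ (c t).1 = q ∧
      ∀ k, stackAt k₀ inSym c k (P k) = (c t).2 k

/-- The argument list runs over all stacks, so it determines the pointer of each stack and the two
pointer functions coincide. -/
theorem holdsConf_runModel {c : ℕ → Q × (K → List A)} {x : List Bool} {q : Q}
    {d : ℕ ⊕ List Bool} {P : K → ℕ ⊕ List Bool} :
    HoldsConf (runModel k₀ inSym c x) q d P ↔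
      ∃ t, d = .inl t ∧ (c t).1 = q ∧ ∀ k, stackAt k₀ inSym c k (P k) = (c t).2 k := by
  constructor
  · rintro ⟨t, P', h, hq, hP⟩
    simp only [List.cons.injEq, List.map_inj_left, Finset.mem_toList, Finset.mem_univ,
      forall_const] at h
    exact ⟨t, h.1, hq, fun k => by rw [h.2, hP]⟩
  · rintro ⟨t, rfl, hq, hP⟩
    exact ⟨t, P, rfl, hq, hP⟩

theorem runModel_confAtom {c : ℕ → Q × (K → List A)} {x : List Bool} {q : Q} {v : Var K}
    {P : K → Var K} {σ : Var K → ℕ ⊕ List Bool} :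
    runModel k₀ inSym c x (confAtom (A := A) q v P).1 ((confAtom (A := A) q v P).2.map σ) ↔
      ∃ t, σ v = .inl t ∧ (c t).1 = q ∧ ∀ k, stackAt k₀ inSym c k (σ (P k)) = (c t).2 k :=
  holds_confAtom.trans holdsConf_runModel

/-- The pair of `a` and `b` is the number aN + b, which is below N² when both digits are below N. -/
theorem runModel_create {c : ℕ → Q × (K → List A)} {x : List Bool} (j : ℕ) :
    (createRule j).Sat (runModel k₀ inSym c x) := by
  intro σ hσ
  simp only [createRule, List.mem_cons, List.not_mem_nil, or_false, forall_eq_or_imp, forall_eq,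
    List.map_cons, List.map_nil, runModel, List.cons.injEq, and_true] at hσ
  obtain ⟨⟨a, ha, ha'⟩, ⟨b, hb, hb'⟩⟩ := hσ
  refine ⟨fun y => match y with
    | .ex _ => .inl (a * orderSize j + b)
    | y => σ y, ?_, ?_⟩
  · simp [createRule]
  · simp only [createRule, List.mem_cons, List.not_mem_nil, or_false, forall_eq_or_imp, forall_eq,
      List.map_cons, List.map_nil]
    refine ⟨⟨a, b, by simp [ha, hb], ha', hb'⟩, ⟨_, rfl, ?_⟩⟩
    rw [orderSize_succ]
    nlinarith

theorem runModel_order {c : ℕ → Q × (K → List A)} {x : List Bool} {j : ℕ} {r : SRule K A Q}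
    (hr : r ∈ orderRules j) : r.Sat (runModel k₀ inSym c x) := by
  have hN := one_lt_orderSize j
  rw [(tame_orderRules (k := 0) hr).full.sat_iff]
  simp only [orderRules, List.mem_cons, List.not_mem_nil, or_false] at hr
  rcases hr with rfl | rfl | rfl | rfl <;> intro σ hσ <;>
  simp only [List.mem_cons, List.not_mem_nil, or_false, forall_eq_or_imp, forall_eq,
    List.map_cons, List.map_nil, runModel, List.cons.injEq, and_true] at hσ ⊢
  · obtain ⟨h0, a, b, ⟨ha, hb, hc⟩, -⟩ := hσ
    rw [h0] at ha hb
    cases ha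
    cases hb
    simpa using hc
  · obtain ⟨⟨n, h0, hn⟩, a, b, ⟨ha, hb, hc⟩, -⟩ := hσ
    rw [h0] at ha hb
    cases ha
    cases hb
    refine ⟨_, hc, ?_⟩
    rw [orderSize_succ, ← hn]
    ring
  · obtain ⟨⟨n, ⟨h0, h0'⟩, hn⟩, ⟨a, b, ⟨ha, hb, hc⟩, hlt, -⟩, ⟨a', b', ⟨ha', hb', hc'⟩, -⟩⟩ := hσ
    rw [ha] at ha'
    rw [h0] at hb
    rw [h0'] at hb'
    cases ha'
    cases hb
    cases hb'
    refine ⟨_, ⟨hc, hc'⟩, ?_⟩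
    rw [orderSize_succ]
    nlinarith
  · obtain ⟨⟨n, ⟨h0, h0'⟩, hn⟩, ⟨m, hm, hm'⟩, hz, ⟨a, b, ⟨ha, hb, hc⟩, -⟩,
      ⟨a', b', ⟨ha', hb', hc'⟩, -⟩⟩ := hσ
    rw [h0] at ha
    rw [h0'] at ha'
    rw [hm] at hb
    rw [hz] at hb'
    cases ha
    cases ha'
    cases hb
    cases hb'
    -- The carry: the maximal digit `m` satisfies m + 1 = N, so the next number has high digit `n +
    -- 1` and low digit 0.
    have e1 : (n + 1) * orderSize j + 0 = n * orderSize j + m + 1 := by rw [← hm']; ring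
    rw [e1] at hc'
    refine ⟨_, ⟨hc, hc'⟩, ?_⟩
    rw [orderSize_succ]
    nlinarith

theorem runModel_top {c : ℕ → Q × (K → List A)} {x : List Bool} {r : SRule K A Q}
    (hr : r ∈ topRules k) : r.Sat (runModel k₀ inSym c x) := by
  rw [(tame_topRules hr).full.sat_iff]
  simp only [topRules, List.mem_cons, List.not_mem_nil, or_false] at hr
  rcases hr with rfl | rfl <;> intro σ hσ <;>
  simp only [List.mem_cons, List.not_mem_nil, or_false, forall_eq, List.map_cons, List.map_nil,
    runModel] at hσ ⊢
  · exact hσ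
  · obtain ⟨a, h, -⟩ := hσ
    exact ⟨a, h⟩

theorem runModel_init {c : ℕ → Q × (K → List A)} {x : List Bool}
    (hc : c 0 = (q₀, initStacks k₀ (x.map inSym))) {r : SRule K A Q}
    (hr : r ∈ initRules k₀ inSym q₀) : r.Sat (runModel k₀ inSym c x) := by
  rw [(tame_initRules (k := 0) hr).full.sat_iff]
  simp only [initRules, List.mem_cons, List.not_mem_nil, or_false] at hr
  rcases hr with rfl | rfl | rfl <;> intro σ hσ <;>
  simp only [List.mem_cons, List.not_mem_nil, or_false, forall_eq]
  · simp only [List.mem_cons, List.not_mem_nil, or_false, forall_eq, List.map_cons, List.map_nil,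
      runModel] at hσ ⊢
    obtain ⟨y, h⟩ := hσ
    exact ⟨_, _, h, by simp [stackAt, initStacks]⟩
  · simp only [List.mem_cons, List.not_mem_nil, or_false, forall_eq, List.map_cons, List.map_nil,
      runModel] at hσ ⊢
    obtain ⟨y, h⟩ := hσ
    exact ⟨_, _, h, by simp [stackAt, initStacks]⟩
  · rw [runModel_confAtom]
    simp only [List.mem_cons, List.not_mem_nil, or_false, forall_eq_or_imp, forall_eq,
      List.map_cons, List.map_nil, runModel, List.cons.injEq, and_true] at hσ
    obtain ⟨h0, ⟨d, rfl, hd⟩, h2⟩ := hσ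
    refine ⟨0, h2, by rw [hc], fun k' => ?_⟩
    by_cases hk : k' = k₀
    · subst hk
      simp [h0, hc, stackAt]
    · simp [hk, hc, hd, initStacks]

/-- Matching the body pins down the actual configuration at time `t`, and the machine is
deterministic, so the head describes the configuration at `t + 1`. A pointer is judged only by the
contents it represents; thus after a push the number `t + 1` is a correct cell, as it represents the
stack at that very time. -/
theorem runModel_instr {c : ℕ → Q × (K → List A)} {x : List Bool}
    (hc : ∀ t, c (t + 1) = microStep δ (c t)) {q : Q} {r : SRule K A Q}
    (hr : r ∈ instrRules q (δ q)) : r.Sat (runModel k₀ inSym c x) := by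
  rw [(tame_instrRules (k := 0) hr).full.sat_iff]
  cases hδ : δ q with
  | idle => simp [hδ, instrRules] at hr
  | push k a q' =>
    rw [hδ] at hr
    obtain rfl := List.mem_singleton.1 hr
    intro σ hσ
    simp only [List.mem_cons, List.not_mem_nil, or_false, forall_eq_or_imp, forall_eq] at hσ ⊢
    rw [runModel_confAtom] at hσ ⊢
    obtain ⟨⟨t, h0, rfl, hP⟩, ⟨t', ht'⟩⟩ := hσ
    simp only [List.map_cons, List.map_nil, h0, List.cons.injEq, Sum.inl.injEq, and_true] at ht'
    obtain ⟨rfl, h1⟩ := ht'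
    have hs : c (t + 1) = (q', Function.update (c t).2 k (a :: (c t).2 k)) := by
      rw [hc, microStep, hδ]
    refine ⟨⟨t + 1, h1, by rw [hs], fun k' => ?_⟩, _, _, rfl, ?_⟩
    · by_cases hk : k' = k
      · subst hk
        simp [h1, stackAt]
      · simp [hk, hs, hP]
    · rw [h1, hP, stackAt, hs]
      simp
  | read rm k next =>
    rw [hδ] at hr
    simp only [instrRules, List.mem_cons, List.mem_map] at hr
    rcases hr with rfl | ⟨a, -, rfl⟩
    · intro σ hσ
      simp only [List.mem_cons, List.not_mem_nil, or_false, forall_eq_or_imp, forall_eq] at hσ ⊢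
      rw [runModel_confAtom] at hσ ⊢
      obtain ⟨⟨t, h0, rfl, hP⟩, ⟨t', ht'⟩, ⟨d, hd, hd'⟩⟩ := hσ
      simp only [List.map_cons, List.map_nil, h0, List.cons.injEq, Sum.inl.injEq, and_true]
        at ht' hd
      obtain ⟨rfl, h1⟩ := ht'
      -- An element satisfying `nil` represents empty contents on every stack, so the stack read is
      -- empty and removing its top changes nothing.
      have hk : (c t).2 k = [] := by rw [← hP, hd, hd']
      have hs : c (t + 1) = (next none, (c t).2) := by
        rw [hc, microStep, hδ]
        cases rm
        · simp [hk]
        · have : Function.update (c t).2 k [] = (c t).2 := by rw [← hk, Function.update_eq_self]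
          simp [hk, this]
      exact ⟨t + 1, h1, by rw [hs], fun k' => by rw [hs]; exact hP k'⟩
    · intro σ hσ
      simp only [List.mem_cons, List.not_mem_nil, or_false, forall_eq_or_imp, forall_eq] at hσ ⊢
      rw [runModel_confAtom] at hσ ⊢
      obtain ⟨⟨t, h0, rfl, hP⟩, ⟨t', ht'⟩, ⟨d, d', hd, hd'⟩⟩ := hσ
      simp only [List.map_cons, List.map_nil, h0, List.cons.injEq, Sum.inl.injEq, and_true]
        at ht' hd
      obtain ⟨rfl, h1⟩ := ht'
      obtain ⟨rfl, rfl⟩ := hd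
      rw [hP] at hd'
      refine ⟨t + 1, h1, ?_, fun k' => ?_⟩
      · rw [hc, microStep, hδ]
        simp [hd']
      · rw [hc, microStep, hδ]
        cases rm with
        | false => exact hP k'
        | true =>
          by_cases hk : k' = k
          · subst hk
            simp [hd']
          · simp [hk, hP]

/-- No time bound is needed: in the model `tsuc` is the successor on all of ℕ, and any match of the
query exhibits a time at which the run is in the accepting state. -/
theorem exists_accepting_of_entails {x : List Bool}
    (h : (reduction δ k₀ inSym q₀ qacc k x).Entails) :
    ∃ t, (microRun δ (q₀, initStacks k₀ (x.map inSym)) t).1 = qacc := by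
  classical
  set c := microRun δ (q₀, initStacks k₀ (x.map inSym)) with hc
  set J : Sym K A Q → List (ℕ ⊕ List Bool) → Prop := runModel k₀ inSym c x with hJ
  let I : Interp (ℕ ⊕ List Bool) :=
    { pred := fun n l => ∃ s : Sym K A Q, s.name = n ∧ J s l
      const := fun n =>
        if n = pairName 1 0 then .inl 0 else if n = pairName 1 1 then .inl 1 else
          -- The name `pairName 0 i` has length `i + 1`, so this is the suffix of `x` of length `i`.
          .inr (x.drop (x.length - (n.length - 1))) }
  have hI : ∀ (s : Sym K A Q) l, I.pred s.name l ↔ J s l := by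
    intro s l
    constructor
    · rintro ⟨s', h, h'⟩
      exact Sym.name_injective h ▸ h'
    · exact fun h => ⟨s, rfl, h⟩
  have hd : ∀ i, I.const (pairName 0 i) = .inr (x.drop (x.length - i)) := by
    intro i
    simp [I, pairName_inj]
    simp [pairName]
  have hc0 : I.const (pairName 1 0) = .inl 0 := by simp [I]
  have hc1 : I.const (pairName 1 1) = .inl 1 := by simp [I, pairName_inj]
  have hq := h (ℕ ⊕ List Bool) I ?_ ?_
  · obtain ⟨σ, hσ⟩ := hq
    have h1 := hσ _ (List.mem_singleton_self _)
    have h2 : J (confAtom (K := K) (A := A) qacc (.v 0) Var.p).1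
        ((confAtom (K := K) (A := A) qacc (.v 0) Var.p).2.map fun y => σ y.name) := by
      rw [← hI]
      simpa [Interp.Holds, Atom.map, SAtom.toAtom, Function.comp_def] using h1
    obtain ⟨t, -, ht, -⟩ := runModel_confAtom.1 h2
    exact ⟨t, ht⟩
  · intro ρ hρ
    obtain ⟨r, hr, rfl⟩ := List.mem_map.1 hρ
    rw [r.satRule_iff I]
    have : (fun (s : Sym K A Q) l => I.pred s.name l) = J := by
      funext s l
      exact propext (hI s l)
    rw [this]
    rcases mem_reductionRules.1 hr with h | h | ⟨q, h⟩ | ⟨j, -, rfl | h⟩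
    · exact runModel_top h
    · exact runModel_init rfl h
    · exact runModel_instr (fun t => microRun_succ _ _ t) h
    · exact runModel_create j
    · exact runModel_order h
  · intro a ha
    obtain ⟨b, hb, rfl⟩ := List.mem_map.1 ha
    refine (hI b.1 (b.2.map I.const)).2 ?_
    rcases List.mem_cons.1 hb with rfl | hb
    · change List.map I.const _ = _
      simp [hd]
    -- The facts are generated by recursion on suffixes, while the constants are interpreted
    -- relative to the whole word `x`; hence the induction keeps the removed prefix `z`.
    · have key : ∀ y z : List Bool, x = z ++ y → ∀ b ∈ inputFacts (K := K) (A := A) (Q := Q) y,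
          J b.1 (b.2.map I.const) := by
        intro y
        induction y with
        | nil =>
          intro z _
          have hN : orderSize 0 = 2 := by norm_num [orderSize]
          simp only [inputFacts, baseFacts, List.mem_cons, List.not_mem_nil, or_false,
            forall_eq_or_imp, forall_eq, List.map_cons, List.map_nil, hc0, hc1, hd, hJ, runModel,
            hN]
          refine ⟨⟨0, rfl, by omega⟩, ⟨1, rfl, by omega⟩, trivial, ⟨1, rfl, rfl⟩,
            ⟨0, rfl, by omega⟩, ⟨_, rfl, fun k => ?_⟩⟩
          by_cases hk : k = k₀
          · subst hk
            simp [stackAt, initStacks]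
          · simp [stackAt, initStacks, hk]
        | cons b y ih =>
          intro z hz a ha
          rcases List.mem_cons.1 ha with rfl | ha
          · refine ⟨y, ?_⟩
            have e1 : x.drop (x.length - (y.length + 1)) = b :: y := by
              rw [hz]; simp
            have e2 : x.drop (x.length - y.length) = y := by
              have hz' : x = (z ++ [b]) ++ y := by simp [hz]
              rw [hz']
              exact List.drop_left' (by simp only [List.length_append]; omega)
            simp [hd, e1, e2]
          · exact ih (z ++ [b]) (by simp [hz]) a ha
      exact key x [] rfl b hb

end Reduction

/-! ### A program that writes the reduction -/

/-- The stacks of the program. -/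
inductive Stk : Type
  | inp
  | out
  | rev
  | tmp
  | cnt
  | acc
  | aux
  | lev
deriving DecidableEq

instance Stk.instFintype : Fintype Stk :=
  ⟨{.inp, .out, .rev, .tmp, .cnt, .acc, .aux, .lev}, fun k => by cases k <;> decide⟩

/-- The stack alphabets: all stacks but those for the input and the output are unary counters. -/
abbrev StkSym : Stk → Type
  | .inp => Bool
  | .out => Letter
  | .rev => Bool
  | .tmp => Unit
  | .cnt => Unit
  | .acc => Unit
  | .aux => Unit
  | .lev => Unit

instance StkSym.instFintype : ∀ k, Fintype (StkSym k)
  | .inp => inferInstanceAs (Fintype Bool)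
  | .out => inferInstanceAs (Fintype Letter)
  | .rev => inferInstanceAs (Fintype Bool)
  | .tmp => inferInstanceAs (Fintype Unit)
  | .cnt => inferInstanceAs (Fintype Unit)
  | .acc => inferInstanceAs (Fintype Unit)
  | .aux => inferInstanceAs (Fintype Unit)
  | .lev => inferInstanceAs (Fintype Unit)

/-- The stacks with given contents. -/
def mkStacks (inp : List Bool) (out : List Letter) (rev : List Bool) (tmp cnt acc aux lev : ℕ) :
    ∀ k, List (StkSym k)
  | .inp => inp
  | .out => out
  | .rev => rev
  | .tmp => List.replicate tmp ()
  | .cnt => List.replicate cnt ()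
  | .acc => List.replicate acc ()
  | .aux => List.replicate aux ()
  | .lev => List.replicate lev ()

/-- The program `c` transforms the stacks `S` into `S'` within `n` steps. -/
def Cmd.RunsIn (c : Cmd StkSym) (S S' : ∀ k, List (StkSym k)) (n : ℕ) : Prop :=
  ∃ t ≤ n, c.Runs S S' t

theorem Cmd.RunsIn.mono {c : Cmd StkSym} {S S' : ∀ k, List (StkSym k)} {m n : ℕ}
    (h : c.RunsIn S S' m) (hmn : m ≤ n) : c.RunsIn S S' n :=
  let ⟨t, ht, hr⟩ := h
  ⟨t, ht.trans hmn, hr⟩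

theorem Cmd.RunsIn.congr {c : Cmd StkSym} {S S' S'' : ∀ k, List (StkSym k)} {m n : ℕ}
    (h : c.RunsIn S S' m) (hS : S' = S'') (hmn : m ≤ n) : c.RunsIn S S'' n :=
  hS ▸ h.mono hmn

theorem Cmd.RunsIn.of_eq {c : Cmd StkSym} {S S' S'' : ∀ k, List (StkSym k)} {n : ℕ}
    (hS : S = S') (h : c.RunsIn S' S'' n) : c.RunsIn S S'' n :=
  hS ▸ h

theorem Cmd.RunsIn.seq {c d : Cmd StkSym} {S S' S'' : ∀ k, List (StkSym k)} {m n : ℕ}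
    (h : c.RunsIn S S' m) (h' : d.RunsIn S' S'' n) : (Cmd.seq c d).RunsIn S S'' (m + n) :=
  let ⟨t, ht, hr⟩ := h
  let ⟨t', ht', hr'⟩ := h'
  ⟨t + t', add_le_add ht ht', hr.seq hr'⟩

theorem Cmd.runsIn_push {k : Stk} {a : StkSym k} {S S' : ∀ k, List (StkSym k)}
    (h : Function.update S k (a :: S k) = S') : (Cmd.push k a).RunsIn S S' 1 :=
  h ▸ ⟨1, le_rfl, .push k a S⟩

theorem runsIn_skip (S : ∀ k, List (StkSym k)) : (Cmd.skip : Cmd StkSym).RunsIn S S 1 :=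
  ⟨1, le_rfl, .skip S⟩

/-- Loops: `G l d` are the stacks when the symbols `l` remain to be processed and the symbols `d`
were processed, most recent first. -/
theorem Cmd.runsIn_each {k : Stk} {b : StkSym k → Cmd StkSym}
    (G : List (StkSym k) → List (StkSym k) → ∀ k, List (StkSym k)) (B : ℕ)
    (l₀ : List (StkSym k)) (hG : ∀ l d, G l d k = l)
    (h : ∀ a l d, d.reverse ++ a :: l = l₀ →
      (b a).RunsIn (Function.update (G (a :: l) d) k l) (G l (a :: d)) B) :
    (Cmd.each k b).RunsIn (G l₀ []) (G [] l₀.reverse) ((B + 1) * l₀.length + 1) := by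
  have key : ∀ l d, d.reverse ++ l = l₀ →
      (Cmd.each k b).RunsIn (G l d) (G [] l₀.reverse) ((B + 1) * l.length + 1) := by
    intro l
    induction l with
    | nil =>
      intro d hd
      refine ⟨1, by simp, ?_⟩
      rw [← hd, List.append_nil, List.reverse_reverse]
      exact .each_nil (hG _ _)
    | cons a l ih =>
      intro d hd
      obtain ⟨t, ht, hr⟩ := h a l d hd
      obtain ⟨t', ht', hr'⟩ := ih (a :: d) (by simp [← hd])
      refine ⟨t + t' + 1, ?_, .each_cons (hG _ _) hr hr'⟩
      rw [List.length_cons, Nat.mul_succ]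
      omega
  exact key l₀ [] (by simp)

-- Arithmetic with unary counters

section Programs

variable {i r : List Bool} {o : List Letter} {t c a x l : ℕ}

theorem push_out (w : Letter) : (Cmd.push (Γ := StkSym) .out w).RunsIn
    (mkStacks i o r t c a x l) (mkStacks i (w :: o) r t c a x l) 1 :=
  Cmd.runsIn_push (by funext k; cases k <;> rfl)

theorem push_tmp : (Cmd.push (Γ := StkSym) .tmp ()).RunsIn
    (mkStacks i o r t c a x l) (mkStacks i o r (t + 1) c a x l) 1 :=
  Cmd.runsIn_push (by funext k; cases k <;> rfl)

theorem push_acc : (Cmd.push (Γ := StkSym) .acc ()).RunsIn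
    (mkStacks i o r t c a x l) (mkStacks i o r t c (a + 1) x l) 1 :=
  Cmd.runsIn_push (by funext k; cases k <;> rfl)

theorem push_aux : (Cmd.push (Γ := StkSym) .aux ()).RunsIn
    (mkStacks i o r t c a x l) (mkStacks i o r t c a (x + 1) l) 1 :=
  Cmd.runsIn_push (by funext k; cases k <;> rfl)

theorem push_lev : (Cmd.push (Γ := StkSym) .lev ()).RunsIn
    (mkStacks i o r t c a x l) (mkStacks i o r t c a x (l + 1)) 1 :=
  Cmd.runsIn_push (by funext k; cases k <;> rfl)

/-- Loops over a counter: `G m n` are the stacks when `m` rounds remain and `n` are done. -/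
theorem Cmd.runsIn_count {k : Stk} {b : StkSym k → Cmd StkSym} (u₀ : StkSym k)
    (hu : ∀ u, u = u₀)
    (G : ℕ → ℕ → ∀ k, List (StkSym k)) (B N : ℕ)
    (hG : ∀ m n, G m n k = List.replicate m u₀)
    (h : ∀ u m n, n + (m + 1) = N →
      (b u).RunsIn (Function.update (G (m + 1) n) k (G m n k)) (G m (n + 1)) B) :
    (Cmd.each k b).RunsIn (G N 0) (G 0 N) ((B + 1) * N + 1) := by
  have hl : ∀ l : List (StkSym k), l = List.replicate l.length u₀ := fun l =>
    List.eq_replicate_iff.2 ⟨rfl, fun u _ => hu u⟩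
  have := Cmd.runsIn_each (b := b) (fun l d => G l.length d.length) B
    (List.replicate N u₀) (fun l d => (hG _ _).trans (hl l).symm) (by
      intro u l d hd
      have hlen := congrArg List.length hd
      simp only [List.length_append, List.length_reverse, List.length_cons,
        List.length_replicate] at hlen
      have := h u l.length d.length hlen
      rw [hG, ← hl] at this
      exact this)
  simpa using this

/-- Move the counter `lev` to the counter `cnt`. -/
theorem move_lev : (Cmd.each (Γ := StkSym) .lev fun _ => .push .cnt ()).RunsIn
    (mkStacks i o r t c a x l) (mkStacks i o r t (c + l) a x 0) (2 * l + 1) :=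
  Cmd.runsIn_count () (fun _ => rfl)
    (fun m n => mkStacks i o r t (c + n) a x m) 1 l (fun _ _ => rfl)
    fun u m n _ => Cmd.runsIn_push (by funext k; cases k <;> rfl)

theorem move_tmp : (Cmd.each (Γ := StkSym) .tmp fun _ => .push .cnt ()).RunsIn
    (mkStacks i o r t c a x l) (mkStacks i o r 0 (c + t) a x l) (2 * t + 1) :=
  Cmd.runsIn_count () (fun _ => rfl)
    (fun m n => mkStacks i o r m (c + n) a x l) 1 t (fun _ _ => rfl)
    fun u m n _ => Cmd.runsIn_push (by funext k; cases k <;> rfl)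

theorem move_tmp_lev : (Cmd.each (Γ := StkSym) .tmp fun _ => .push .lev ()).RunsIn
    (mkStacks i o r t c a x l) (mkStacks i o r 0 c a x (l + t)) (2 * t + 1) :=
  Cmd.runsIn_count () (fun _ => rfl)
    (fun m n => mkStacks i o r m c a x (l + n)) 1 t (fun _ _ => rfl)
    fun u m n _ => Cmd.runsIn_push (by funext k; cases k <;> rfl)

theorem move_aux : (Cmd.each (Γ := StkSym) .aux fun _ => .push .acc ()).RunsIn
    (mkStacks i o r t c a x l) (mkStacks i o r t c (a + x) 0 l) (2 * x + 1) :=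
  Cmd.runsIn_count () (fun _ => rfl)
    (fun m n => mkStacks i o r t c (a + n) m l) 1 x (fun _ _ => rfl)
    fun u m n _ => Cmd.runsIn_push (by funext k; cases k <;> rfl)

theorem clear_lev : (Cmd.each (Γ := StkSym) .lev fun _ => .skip).RunsIn
    (mkStacks i o r t c a x l) (mkStacks i o r t c a x 0) (2 * l + 1) :=
  Cmd.runsIn_count () (fun _ => rfl) (fun m _ => mkStacks i o r t c a x m) 1 l (fun _ _ => rfl)
    fun u m n _ => by
      convert runsIn_skip _ using 1
      funext k; cases k <;> rfl

theorem clear_cnt : (Cmd.each (Γ := StkSym) .cnt fun _ => .skip).RunsIn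
    (mkStacks i o r t c a x l) (mkStacks i o r t 0 a x l) (2 * c + 1) :=
  Cmd.runsIn_count () (fun _ => rfl) (fun m _ => mkStacks i o r t m a x l) 1 c (fun _ _ => rfl)
    fun u m n _ => by
      convert runsIn_skip _ using 1
      funext k; cases k <;> rfl

theorem reverse_inp : (Cmd.each (Γ := StkSym) .inp fun b => .push .rev b).RunsIn
    (mkStacks i o [] t c a x l) (mkStacks [] o i.reverse t c a x l) (2 * i.length + 1) :=
  Cmd.runsIn_each (k := .inp) (fun l' d => mkStacks l' o d t c a x l) 1 i (fun _ _ => rfl)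
    fun u m n _ => Cmd.runsIn_push (by funext k; cases k <;> rfl)

/-- Add `cnt + 1` to the counter `aux`. -/
def addCnt : Cmd StkSym :=
  .seq (.push .aux ()) (.seq (.each .cnt fun _ => .seq (.push .tmp ()) (.push .aux ()))
    (.each .tmp fun _ => .push .cnt ()))

theorem runsIn_addCnt : addCnt.RunsIn
    (mkStacks i o r 0 c a x l) (mkStacks i o r 0 c a (x + (c + 1)) l)
    (5 * c + 3) := by
  have h1 : (Cmd.each (Γ := StkSym) .cnt fun _ => .seq (.push .tmp ()) (.push .aux ())).RunsIn
      (mkStacks i o r 0 c a (x + 1) l) (mkStacks i o r c 0 a (x + 1 + c) l) (3 * c + 1) :=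
    Cmd.runsIn_count () (fun _ => rfl)
    (fun m n => mkStacks i o r n m a (x + 1 + n) l) 2 c
      (fun _ _ => rfl)
      fun u m n _ => .of_eq (S' := mkStacks i o r n m a (x + 1 + n) l)
        (by funext k; cases k <;> rfl) (push_tmp.seq push_aux)
  exact (push_aux.seq (h1.seq move_tmp)).congr (by rw [Nat.zero_add, add_assoc, add_comm 1])
    (by omega)

/-- Multiply the counter `acc` by `cnt + 1`. -/
def mulCnt : Cmd StkSym :=
  .seq (.each .acc fun _ => addCnt) (.each .aux fun _ => .push .acc ())

theorem runsIn_mulCnt : mulCnt.RunsIn (mkStacks i o r 0 c a 0 l)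
    (mkStacks i o r 0 c (a * (c + 1)) 0 l) ((7 * c + 6) * a + 2) := by
  have h1 : (Cmd.each (Γ := StkSym) .acc fun _ => addCnt).RunsIn
      (mkStacks i o r 0 c a 0 l) (mkStacks i o r 0 c 0 (a * (c + 1)) l)
      ((5 * c + 3 + 1) * a + 1) := by
    have := Cmd.runsIn_count (k := .acc) (b := fun _ => addCnt) () (fun _ => rfl)
      (fun m n => mkStacks i o r 0 c m (n * (c + 1)) l) (5 * c + 3) a (fun _ _ => rfl)
      fun u m n _ => by
        convert runsIn_addCnt (i := i) (o := o) (r := r) (c := c) (a := m) (x := n * (c + 1))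
          (l := l) using 1
        · funext k; cases k <;> rfl
        · rw [Nat.succ_mul]
    simpa using this
  exact (h1.seq move_aux).congr (by rw [Nat.zero_add]) (by ring_nf; omega)

/-- Multiply the counter `acc` by `(cnt + 1) ^ d`. -/
def powCnt : ℕ → Cmd StkSym
  | 0 => .skip
  | d + 1 => .seq (powCnt d) mulCnt

/-- The exponent is built into the program as `d` successive multiplications, so the time is
polynomial in the counter for fixed `b` and `d`. -/
theorem runsIn_powCnt (b d : ℕ) : ∃ p : Polynomial ℕ, ∀ (c : ℕ) (i r o l),
    (powCnt d).RunsIn (mkStacks i o r 0 c b 0 l) (mkStacks i o r 0 c (b * (c + 1) ^ d) 0 l)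
      (p.eval c) := by
  induction d with
  | zero => exact ⟨1, fun c i r o l => (runsIn_skip _).congr (by simp) (by simp)⟩
  | succ d ih =>
    obtain ⟨p, hp⟩ := ih
    refine ⟨p + ((7 * .X + 6) * (.C b * (.X + 1) ^ d) + 2), fun c i r o l =>
      ((hp c i r o l).seq runsIn_mulCnt).congr ?_ ?_⟩
    · rw [pow_succ, mul_assoc]
    · simp

/-- Push `b` symbols on the counter `acc`. -/
def pushAcc : ℕ → Cmd StkSym
  | 0 => .skip
  | b + 1 => .seq (pushAcc b) (.push .acc ())

theorem runsIn_pushAcc (b : ℕ) :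
    (pushAcc b).RunsIn (mkStacks i o r t c 0 x l) (mkStacks i o r t c b x l) (b + 1) := by
  induction b with
  | zero => exact runsIn_skip _
  | succ b ih => exact ih.seq push_acc

/-! ### Words that can be written -/

/-- There is a program that writes the word `f n` in linear time if the counter `lev` is `n`. -/
def Emittable (f : ℕ → List Letter) : Prop :=
  ∃ (p : Cmd StkSym) (C : ℕ), ∀ i o r c a x l,
    p.RunsIn (mkStacks i o r 0 c a x l) (mkStacks i (f l ++ o) r 0 c a x l) (C * (l + 1))

/-- Pushing makes the last letter written the first of the word, so the second word has to be
written before the first. -/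
theorem Emittable.append {f g : ℕ → List Letter} (hf : Emittable f) (hg : Emittable g) :
    Emittable fun n => f n ++ g n := by
  obtain ⟨p, C, hp⟩ := hf
  obtain ⟨q, D, hq⟩ := hg
  exact ⟨.seq q p, D + C, fun i o r c a x l => ((hq i o r c a x l).seq (hp _ _ _ _ _ _ _)).congr
    (by rw [List.append_assoc]) (by rw [add_mul])⟩

theorem emittable_nil : Emittable fun _ => [] :=
  ⟨.skip, 1, fun _ _ _ _ _ _ _ => (runsIn_skip _).congr rfl (by omega)⟩

theorem Emittable.cons {f : ℕ → List Letter} (w : Letter) (hf : Emittable f) :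
    Emittable fun n => w :: f n := by
  obtain ⟨p, C, hp⟩ := hf
  exact ⟨.seq p (.push .out w), C + 1, fun i o r c a x l =>
    ((hp i o r c a x l).seq (push_out w)).congr rfl (by rw [add_mul]; omega)⟩

theorem emittable_const (w : List Letter) : Emittable fun _ => w := by
  induction w with
  | nil => exact emittable_nil
  | cons a w ih => exact ih.cons a

theorem emittable_replicate : Emittable fun n => List.replicate n (.bit true) := by
  -- Reading the counter empties it; the copy in `tmp` restores it afterwards.
  refine ⟨.seq (.each .lev fun _ => .seq (.push .tmp ()) (.push .out (.bit true)))
    (.each .tmp fun _ => .push .lev ()), 5, fun i o r c a x l => ?_⟩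
  have h1 : (Cmd.each (Γ := StkSym) .lev fun _ =>
      .seq (.push .tmp ()) (.push .out (.bit true))).RunsIn (mkStacks i o r 0 c a x l)
      (mkStacks i (List.replicate l (.bit true) ++ o) r l c a x 0) (3 * l + 1) :=
    Cmd.runsIn_count () (fun _ => rfl)
      (fun m n => mkStacks i (List.replicate n (.bit true) ++ o) r n c a x m) 2 l (fun _ _ => rfl)
      fun u m n _ => .of_eq (S' := mkStacks i (List.replicate n (.bit true) ++ o) r n c a x m)
        (by funext k; cases k <;> rfl) (push_tmp.seq (push_out (.bit true)))
  exact (h1.seq move_tmp_lev).congr (by rw [Nat.zero_add]) (by omega)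

theorem emittable_encName (w : Name) (m : ℕ) :
    Emittable fun n => encName (w ++ List.replicate (n + m) true) := by
  have h : ∀ n, encName (w ++ List.replicate (n + m) true) = w.map Letter.bit ++
      (List.replicate n (.bit true) ++ (List.replicate m (.bit true) ++ [.close])) := by
    intro n
    simp only [encName, List.map_append, List.map_replicate, List.append_assoc]
    rw [List.replicate_add, List.append_assoc]
  simp only [h]
  exact (emittable_const _).append (emittable_replicate.append (emittable_const _))

theorem emittable_pairName (m k : ℕ) : Emittable fun n => encName (pairName m (n + k)) := by
  have := emittable_encName (List.replicate m true ++ [false]) k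
  simpa [pairName] using this

/-- Names end with their index in unary, so an index `n + m` costs a fixed prefix, a copy of the
counter and `m` further bits. -/
theorem emittable_sym {K A Q : Type} [Fintype K] [Fintype A] [Fintype Q] (s : ℕ → Sym K A Q)
    (ar tag m : ℕ) (h : ∀ n, (s n).arity = ar ∧ (s n).tag = tag ∧ (s n).index = n + m) :
    Emittable fun n => encName (s n).name := by
  have := emittable_encName
    (List.replicate ar true ++ false :: (List.replicate tag true ++ [false])) m
  simpa [Sym.name, h, pairName] using this

/-- The code of a list without the closing symbol. -/
def encItems {α : Type} (e : α → List Letter) (l : List α) : List Letter :=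
  l.flatMap fun a => .item :: e a

/-- Only the end of a list carries a closing symbol, so items can be prepended to a code that is
already on the output stack. -/
theorem encList_append {α : Type} (e : α → List Letter) (l l' : List α) :
    encList e (l ++ l') = encItems e l ++ encList e l' := by
  induction l with
  | nil => rfl
  | cons a l ih => simp [encList, encItems] at ih ⊢; exact ih

end Programs

-- Writing the instance

section Writer

variable {K A Q : Type} [Fintype K] [Fintype A] [Fintype Q]

/-- The code of the rules for level `n`. -/
noncomputable def levelWord (K A Q : Type) [Fintype K] [Fintype A] [Fintype Q] (n : ℕ) :
    List Letter :=
  encItems encRule ((createRule n :: orderRules n : List (SRule K A Q)).map SRule.toRule)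

theorem emittable_levelWord : Emittable (levelWord K A Q) := by
  have dom0 := emittable_sym (fun n => (.dom n : Sym K A Q)) _ _ 0 fun _ => ⟨rfl, rfl, rfl⟩
  have dom1 := emittable_sym (fun n => (.dom (n + 1) : Sym K A Q)) _ _ 1 fun _ => ⟨rfl, rfl, rfl⟩
  have min0 := emittable_sym (fun n => (.min n : Sym K A Q)) _ _ 0 fun _ => ⟨rfl, rfl, rfl⟩
  have min1 := emittable_sym (fun n => (.min (n + 1) : Sym K A Q)) _ _ 1 fun _ => ⟨rfl, rfl, rfl⟩
  have max0 := emittable_sym (fun n => (.max n : Sym K A Q)) _ _ 0 fun _ => ⟨rfl, rfl, rfl⟩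
  have max1 := emittable_sym (fun n => (.max (n + 1) : Sym K A Q)) _ _ 1 fun _ => ⟨rfl, rfl, rfl⟩
  have suc0 := emittable_sym (fun n => (.suc n : Sym K A Q)) _ _ 0 fun _ => ⟨rfl, rfl, rfl⟩
  have suc1 := emittable_sym (fun n => (.suc (n + 1) : Sym K A Q)) _ _ 1 fun _ => ⟨rfl, rfl, rfl⟩
  have pair0 := emittable_sym (fun n => (.pair n : Sym K A Q)) _ _ 0 fun _ => ⟨rfl, rfl, rfl⟩
  have ex : Emittable fun n => encName (Var.ex n : Var K).name := emittable_pairName 2 0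
  have e : levelWord K A Q = fun n => levelWord K A Q n := rfl
  rw [e]
  simp only [levelWord, encItems, createRule, orderRules, SRule.toRule, encRule, encList, encAtom,
    SAtom.toAtom, List.map_cons, List.map_nil, List.flatMap_cons, List.flatMap_nil]
  repeat' with_reducible first
    | exact emittable_const _ | assumption | apply Emittable.append | apply Emittable.cons

theorem emittable_topRules : Emittable fun n =>
    encItems encRule ((topRules n : List (SRule K A Q)).map SRule.toRule) := by
  have h2 := emittable_sym (fun n => (.min n : Sym K A Q)) _ _ 0 fun _ => ⟨rfl, rfl, rfl⟩
  have h4 := emittable_sym (fun n => (.suc n : Sym K A Q)) _ _ 0 fun _ => ⟨rfl, rfl, rfl⟩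
  simp only [encItems, topRules, SRule.toRule, encRule, encList, encAtom,
    SAtom.toAtom, List.map_cons, List.map_nil, List.flatMap_cons, List.flatMap_nil]
  repeat' with_reducible first
    | exact emittable_const _ | assumption | apply Emittable.append | apply Emittable.cons

theorem emittable_inp (b : Bool) : Emittable fun n => Letter.item :: encAtom
    (toFact ((.inp b : Sym K A Q), [pairName 0 (n + 1), pairName 0 n])) := by
  simp only [toFact, encAtom, encList]
  have h1 := emittable_pairName 0 1
  have h0 : Emittable fun n => encName (pairName 0 n) := emittable_pairName 0 0
  repeat' with_reducible first
    | exact emittable_const _ | assumption | apply Emittable.append | apply Emittable.cons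

theorem emittable_start : Emittable fun n => Letter.item :: encAtom
    (toFact ((.start : Sym K A Q), [pairName 0 n])) := by
  simp only [toFact, encAtom, encList]
  have h0 : Emittable fun n => encName (pairName 0 n) := emittable_pairName 0 0
  repeat' with_reducible first
    | exact emittable_const _ | assumption | apply Emittable.append | apply Emittable.cons

variable [DecidableEq K]

/-- The reduction is computable in polynomial time. -/
theorem reduction_computable (δ : Q → Instr K A Q) (k₀ : K) (inSym : Bool → A) (q₀ qacc : Q)
    (b d : ℕ) : Nonempty (Turing.TM2ComputableInPolyTime (id : List Bool → List Bool)
      Instance.encode fun x => reduction δ k₀ inSym q₀ qacc (b * (x.length + 1) ^ d) x) := by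
  set R := machineRules δ k₀ inSym q₀ with hR
  set qw := encList encAtom [SAtom.toAtom (confAtom (K := K) (A := A) qacc (.v 0) Var.p)] with hqw
  obtain ⟨pBase, cBase, hBase⟩ := emittable_const
    (encList encAtom ((baseFacts K A Q).map toFact) ++ qw)
  have hInp := fun b => emittable_inp (K := K) (A := A) (Q := Q) b
  choose pInp cInp hInp using hInp
  obtain ⟨pStart, cStart, hStart⟩ := emittable_start (K := K) (A := A) (Q := Q)
  obtain ⟨pMach, cMach, hMach⟩ := emittable_const (encList encRule (R.map SRule.toRule))
  obtain ⟨pLev, cLev, hLev⟩ := emittable_levelWord (K := K) (A := A) (Q := Q)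
  obtain ⟨pTop, cTop, hTop⟩ := emittable_topRules (K := K) (A := A) (Q := Q)
  obtain ⟨pow, hpow⟩ := runsIn_powCnt b d
  -- The output is written from its end. Reversing the input makes its last letter come first, and
  -- `lev` counts the suffix treated so far, which provides the indices of its constants. The length
  -- then moves to `cnt`, and `acc` becomes the number of levels b(n+1)^d. In the level loop `lev`
  -- climbs from 0 to that number, the value needed for the top rules.
  let prog : Cmd StkSym :=
    .seq pBase <| .seq (.each .inp fun b => .push .rev b) <|
    .seq (.each .rev fun b => .seq (pInp b) (.push .lev ())) <|
    .seq pStart <| .seq (.each .lev fun _ => .push .cnt ()) <|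
    .seq (pushAcc b) <| .seq (powCnt d) <| .seq pMach <|
    .seq (.each .acc fun _ => .seq pLev (.push .lev ())) <|
    .seq pTop <| .seq (.each .lev fun _ => .skip) (.each .cnt fun _ => .skip)
  have hfacts : ∀ x : List Bool, (Cmd.each (Γ := StkSym) .rev fun b =>
      .seq (pInp b) (.push .lev ())).RunsIn
      (mkStacks [] (encList encAtom ((baseFacts K A Q).map toFact) ++ qw) x.reverse 0 0 0 0 0)
      (mkStacks [] (encList encAtom ((inputFacts (K := K) (A := A) (Q := Q) x).map toFact) ++ qw) []
        0 0 0 0 x.length)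
      (((cInp true + cInp false) * (x.length + 1) + 1 + 1) * x.length + 1) := by
    intro x
    have := Cmd.runsIn_each (k := .rev) (b := fun b => .seq (pInp b) (.push .lev ()))
      (fun l d => mkStacks [] (encList encAtom
        ((inputFacts (K := K) (A := A) (Q := Q) d).map toFact) ++ qw) l 0 0 0 0 d.length)
      ((cInp true + cInp false) * (x.length + 1) + 1) x.reverse (fun _ _ => rfl) ?_
    · rw [List.reverse_reverse, List.length_reverse] at this
      exact this
    · intro u l d hd
      have hlen : d.length ≤ x.length := by
        have := congrArg List.length hd
        simp only [List.length_append, List.length_reverse, List.length_cons] at this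
        omega
      refine .of_eq (S' := mkStacks [] (encList encAtom
        ((inputFacts (K := K) (A := A) (Q := Q) d).map toFact) ++ qw) l 0 0 0 0 d.length)
        (by funext k; cases k <;> rfl) ((((hInp u) _ _ _ _ _ _ _).seq push_lev).congr ?_ ?_)
      · simp only [inputFacts, List.map_cons, encList, List.cons_append, List.append_assoc,
          List.length_cons]
      -- The sum of the two constants bounds the cost for either input letter.
      · refine add_le_add (Nat.mul_le_mul ?_ (by omega)) le_rfl
        cases u <;> omega
  have hlevels : ∀ (k n : ℕ) (o : List Letter), (Cmd.each (Γ := StkSym) .acc fun _ =>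
      .seq pLev (.push .lev ())).RunsIn
      (mkStacks [] (encList encRule (R.map SRule.toRule) ++ o) [] 0 n k 0 0)
      (mkStacks [] (encList encRule ((withLevels R k).map SRule.toRule) ++ o) [] 0 n 0 0 k)
      ((cLev * (k + 1) + 1 + 1) * k + 1) := by
    intro k n o
    refine Cmd.runsIn_count (k := .acc) (b := fun _ => .seq pLev (.push .lev ())) () (fun _ => rfl)
      (fun m j => mkStacks [] (encList encRule ((withLevels R j).map SRule.toRule) ++ o) [] 0 n m 0
        j) (cLev * (k + 1) + 1) k (fun _ _ => rfl) ?_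
    intro u m j hj
    refine .of_eq (S' := mkStacks [] (encList encRule ((withLevels R j).map SRule.toRule) ++ o)
      [] 0 n m 0 j) (by funext k; cases k <;> rfl) (((hLev _ _ _ _ _ _ _).seq push_lev).congr ?_ ?_)
    · rw [withLevels, ← List.cons_append, List.map_append, encList_append, List.append_assoc]
      rfl
    · exact add_le_add (Nat.mul_le_mul_left _ (by omega)) le_rfl
  let X : Polynomial ℕ := .X
  let k : Polynomial ℕ := .C b * (X + 1) ^ d
  refine Cmd.computableInPolyTime (k₀ := Stk.inp) (k₁ := Stk.out) _ _ _ prog (Equiv.refl Bool)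
    (Equiv.refl Letter)
    (.C cBase + ((2 * X + 1) + ((((.C (cInp true + cInp false)) * (X + 1) + 1 + 1) * X + 1) +
      (.C cStart * (X + 1) + ((2 * X + 1) + ((.C b + 1) + (pow + (.C cMach +
      ((((.C cLev) * (k + 1) + 1 + 1) * k + 1) + (.C cTop * (k + 1) +
      ((2 * k + 1) + (2 * X + 1)))))))))))) fun x => ?_
  have hk : k.eval x.length = b * (x.length + 1) ^ d := by simp [k, X]
  have hX : X.eval x.length = x.length := by simp [X]
  have hinit : mkStacks x [] [] 0 0 0 0 0 =
      Function.update (β := fun k => List (StkSym k)) (fun _ => []) Stk.inp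
        (List.map (Equiv.refl Bool).symm (id x)) := by
    funext k; cases k <;> simp [mkStacks]
  have hfinal : ∀ w : List Letter, mkStacks [] w [] 0 0 0 0 0 =
      Function.update (β := fun k => List (StkSym k)) (fun _ => []) Stk.out
        (w.map (Equiv.refl Letter).symm) := by
    intro w
    funext k; cases k <;> simp [mkStacks]
  have hB : pBase.RunsIn (mkStacks x [] [] 0 0 0 0 0)
      (mkStacks x (encList encAtom ((baseFacts K A Q).map toFact) ++ qw) [] 0 0 0 0 0) cBase :=
    (hBase x [] [] 0 0 0 0).congr (by rw [List.append_nil]) (by omega)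
  have hrun := hB.seq (reverse_inp.seq ((hfacts x).seq
    ((hStart _ _ _ _ _ _ _).seq (move_lev.seq ((runsIn_pushAcc b).seq ((hpow _ _ _ _ _).seq
      ((hMach _ _ _ _ _ _ _).seq ((hlevels _ _ _).seq ((hTop _ _ _ _ _ _ _).seq
        (clear_lev.seq clear_cnt))))))))))
  simp only [Nat.zero_add, mul_one] at hrun
  have hout : ∀ k, (reduction δ k₀ inSym q₀ qacc k x).encode =
      encItems encRule ((topRules k).map (SRule.toRule (K := K) (A := A) (Q := Q))) ++
        (encList encRule ((withLevels R k).map SRule.toRule) ++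
          (Letter.item :: encAtom (toFact ((.start : Sym K A Q), [pairName 0 x.length])) ++
            (encList encAtom ((inputFacts (K := K) (A := A) (Q := Q) x).map toFact) ++ qw))) := by
    intro k
    simp only [Instance.encode, reduction, reductionRules, reductionFacts, List.map_append,
      encList_append, List.map_cons, ← hR, ← hqw, List.append_assoc]
    rw [encList]
    simp only [List.cons_append, List.append_assoc]
  rw [← hinit]
  refine hrun.congr ?_ (le_of_eq ?_)
  · rw [hfinal, hout]
  · simp only [Polynomial.eval_add, Polynomial.eval_mul, Polynomial.eval_C, Polynomial.eval_one,
      Polynomial.eval_ofNat, id_eq, hk, hX]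

end Writer
end ExRules

-- The hardness theorem

theorem theorem7 :
    ExRules.TwoExpTimeHard ExRules.Instance.encode
      (fun i => i.WellFormed ∧ ExRules.IsEMFA i.rules)
      (fun i => i.Entails) := by
  intro L hL
  obtain ⟨K, A, Q, _, _, _, _, δ, k₀, inSym, q₀, qacc, b, d, hb, hM⟩ := hL.exists_micro
  refine ⟨fun x => ExRules.reduction δ k₀ inSym q₀ qacc (b * (x.length + 1) ^ d) x,
    ExRules.reduction_computable δ k₀ inSym q₀ qacc b d, fun x => ⟨⟨?_, ?_⟩, ?_⟩⟩
  -- Since b > 0 there is at least one level; with none, the fact predicates `dom 0` and `max 0`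
  -- would not occur in any rule.
  · exact ExRules.reduction_wellFormed (by positivity) x
  · exact ExRules.reduction_isEMFA x
  · constructor
    · intro hx
      obtain ⟨t, ht, hacc⟩ := (hM x).1 hx
      exact ExRules.entails_reduction ht hacc
    · intro h
      obtain ⟨t, ht⟩ := ExRules.exists_accepting_of_entails h
      exact (hM x).2 t ht
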